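/- Let $m\ge 0$ be an integer and let $\alpha,\beta,\omega$ be real numbers such that the Jacobi polynomial $P_m=P_m^{(-\alpha-1,\,\beta-1)}$ is not identically zero. Here $P_n^{(a,b)}(x)=\frac{(a+1)_n}{n!}\,{}_2F_1\!\left(-n,\,n+a+b+1;\,a+1;\,\tfrac{1-x}{2}\right)$, continued polynomially to all real $a,b$. Put $x=-\cos 2\theta$ with $0<\theta<\pi/2$, and $$W=\frac{d}{dx}\ln\Big((1+x)^{\beta/2-1/4}(1-x)^{-\alpha/2-1/4}P_m(x)\Big),$$ $$A=2\sqrt{1-x^2}\Big(\frac{d}{dx}-W\Big),\qquad A^\dagger=2\sqrt{1-x^2}\Big(-\frac{d}{dx}-W\Big),$$ so that $2\sqrt{1-x^2}\,\frac{d}{dx}=\partial_\theta$. Let $$L_2=L^{(2)}=AA^\dagger+(2m-\alpha+\beta-1)^2,\qquad H=-\frac1{2r}\,\partial_r\, r\,\partial_r+\frac12\omega^2r^2+\frac1{2r^2}L^{(2)},$$ acting on smooth complex-valued functions of the polar coordinates $(r,\theta)$ on the open set $U=\{r>0,\ 0<\theta<\pi/2,\ P_m(-\cos 2\theta)\neq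 0\}$. Put $\delta=(\alpha+\beta)(\alpha-\beta+2)$ and define $L_4$ by $$2L_4=A\Big(2(1-x^2)\frac{\partial}{\partial x}\Big)A^\dagger\Big(\frac1{r^2}-\frac1r\frac{\partial}{\partial r}\Big)+A\,x\,A^\dagger\Big(\frac1r\frac{\partial}{\partial r}-\frac{L_2}{r^2}+H\Big)-\frac{\delta}{r^2}AA^\dagger .$$ Then the following hold. 1. $L^{(2)}$ is a rational extension of the trigonometric operator: $$A^\dagger A+(2m-\alpha+\beta-1)^2=-\partial_\theta^2+\frac{(\alpha+1)^2-\frac14}{\cos^2\theta}+\frac{(\beta-1)^2-\frac14}{\sin^2\theta},$$ $$L^{(2)}=-\partial_\theta^2+v(\theta),\qquad v(\theta)=\frac{\alpha^2-\frac14}{\cos^2\theta}+\frac{\beta^2-\frac14}{\sin^2\theta}-2\,\frac{d^2}{d\theta^2}\ln|P_m(-\cos2\theta)|.$$ 2. $H$ is superintegrable: $H,L_2,L_4$ are algebraically independent differential operators (no nonzero polynomial, with its monomials evaluated as symmetrized products, vanishes on them), and $[H,L_2]=[H,L_4]=0$. 3. $L_2$ is a differential operator of second order, and is the integral associated with separation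 of variables in polar coordinates: if $\Phi(r,\theta)=R(r)\Psi(\theta)$ is smooth and $-\Psi''+v\Psi=\lambda\Psi$, then $L_2\Phi=\lambda\Phi$ and $H\Phi=\big(-\frac1{2r}(rR')'+\frac12\omega^2r^2R+\frac{\lambda}{2r^2}R\big)\Psi$. 4. $L_4$ is a differential operator of fourth order, and is built from the Jacobi and Laguerre ladder operators. Put $$B_\Lambda=A\big(2(1-\Lambda)(1-x^2)\partial_x+\Lambda(1-\Lambda)x-\delta\big)A^\dagger,\qquad C_{\Lambda,E}=\frac{\Lambda+1}{r}\partial_r-\frac{\Lambda(\Lambda+1)}{r^2}+E .$$ For $\Lambda\notin\{0,1,-1\}$, on every smooth $\Phi$ with $L_2\Phi=\Lambda^2\Phi$ and $H\Phi=E\Phi$, $$L_4\Phi=\Big(\frac{B_\Lambda C_{-\Lambda,E}}{4\Lambda(1-\Lambda)}-\frac{B_{-\Lambda}C_{\Lambda,E}}{4\Lambda(1+\Lambda)}+\frac{\delta E}{2(1-\Lambda^2)}AA^\dagger\Big)\Phi .$$ 5. With $p_1=\partial_{x_1}$, $p_2=\partial_{x_2}$ the Cartesian derivatives ($x_1=r\cos\theta$,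 $x_2=r\sin\theta$) and $M=\partial_\theta$, the operator $L_4+\frac14(p_1^2-p_2^2)M^2$ has order at most three. So the leading term of $L_4$ is $-\frac14(p_1^2-p_2^2)M^2$, independently of $m,\alpha,\beta,\omega$. -/

import Mathlib

open scoped ContDiff

namespace RosenMorse

noncomputable section

/-! ### Differential operators on smooth functions of two real variables `(r, θ)` -/

/-- The complex vector space `C^∞(U)` of smooth complex-valued functions on the open set `U`.
A smooth function on `U` is represented by its extension by zero to the whole plane. -/
def Smooth (U : TopologicalSpace.Opens (ℝ × ℝ)) : Submodule ℂ (ℝ × ℝ → ℂ) where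
  carrier := {f | ContDiffOn ℝ ∞ f (U : Set (ℝ × ℝ)) ∧ ∀ p, p ∉ U → f p = 0}
  add_mem' := by
    rintro f g ⟨hf, hf0⟩ ⟨hg, hg0⟩
    exact ⟨hf.add hg, fun p hp => by simp [hf0 p hp, hg0 p hp]⟩
  zero_mem' := ⟨contDiffOn_const, fun _ _ => rfl⟩
  smul_mem' := by
    rintro c f ⟨hf, hf0⟩
    exact ⟨hf.const_smul c, fun p hp => by simp [hf0 p hp]⟩

/-- Linear operators on `C^∞(U)`; the product is composition. -/
abbrev Operator (U : TopologicalSpace.Opens (ℝ × ℝ)) : Type := Module.End ℂ (Smooth U)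

theorem Smooth.differentiableAt {U : TopologicalSpace.Opens (ℝ × ℝ)} (f : Smooth U)
    {p : ℝ × ℝ} (hp : p ∈ U) : DifferentiableAt ℝ (f : ℝ × ℝ → ℂ) p :=
  (f.2.1.contDiffAt (U.isOpen.mem_nhds hp)).differentiableAt (by simp)

theorem indicator_mem_smooth {U : TopologicalSpace.Opens (ℝ × ℝ)} {g : ℝ × ℝ → ℂ}
    (hg : ContDiffOn ℝ ∞ g (U : Set (ℝ × ℝ))) :
    (U : Set (ℝ × ℝ)).indicator g ∈ Smooth U :=
  ⟨hg.congr fun _ hp => Set.indicator_of_mem hp g, fun _ hp => Set.indicator_of_notMem hp g⟩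

/-- The derivative on `C^∞(U)` in the constant coordinate direction `v`. -/
def dirDeriv (U : TopologicalSpace.Opens (ℝ × ℝ)) (v : ℝ × ℝ) : Operator U where
  toFun f := ⟨(U : Set (ℝ × ℝ)).indicator fun p => fderiv ℝ (f : ℝ × ℝ → ℂ) p v,
    indicator_mem_smooth
      ((f.2.1.fderiv_of_isOpen (m := ∞) U.isOpen (by simp)).clm_apply contDiffOn_const)⟩
  map_add' f g := by
    ext p
    by_cases hp : p ∈ U
    · simp [hp, fderiv_add (Smooth.differentiableAt f hp) (Smooth.differentiableAt g hp)]
    · simp [hp]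
  map_smul' c f := by
    ext p
    by_cases hp : p ∈ U
    · simp [hp, fderiv_const_smul (Smooth.differentiableAt f hp) c]
    · simp [hp]

/-- The operator `∂_r`. -/
def dr (U : TopologicalSpace.Opens (ℝ × ℝ)) : Operator U := dirDeriv U (1, 0)

/-- The operator `∂_θ`, the generator `M` of rotations. -/
def dθ (U : TopologicalSpace.Opens (ℝ × ℝ)) : Operator U := dirDeriv U (0, 1)

/-- Multiplication by the real function `g`, smooth on `U`. -/
def mulOp (U : TopologicalSpace.Opens (ℝ × ℝ)) (g : ℝ × ℝ → ℝ)
    (hg : ContDiffOn ℝ ∞ g (U : Set (ℝ × ℝ))) : Operator U where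
  toFun f := ⟨fun p => g p • (f : ℝ × ℝ → ℂ) p,
    hg.smul f.2.1, fun p hp => by simp [f.2.2 p hp]⟩
  map_add' f h := by
    ext p
    simp
  map_smul' c f := by
    ext p
    simp
    ring

/-- `D` is a linear differential operator of order at most `k` with smooth coefficients. -/
def IsDiffOp (U : TopologicalSpace.Opens (ℝ × ℝ)) (k : ℕ) (D : Operator U) : Prop :=
  ∃ a : ℕ → ℕ → ℝ × ℝ → ℂ,
    (∀ i j, ContDiffOn ℝ ∞ (a i j) (U : Set (ℝ × ℝ))) ∧
    ∀ (f : Smooth U), ∀ p ∈ U, (D f : ℝ × ℝ → ℂ) p =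
      ∑ i ∈ Finset.range (k + 1), ∑ j ∈ Finset.range (k + 1 - i),
        a i j p * ((dr U ^ i * dθ U ^ j) f : ℝ × ℝ → ℂ) p

/-- `L` is an integral of motion of `H`: a finite-order linear differential operator
commuting with `H`. -/
def IsIntegral (U : TopologicalSpace.Opens (ℝ × ℝ)) (H L : Operator U) : Prop :=
  (∃ k, IsDiffOp U k L) ∧ H * L = L * H

/-- The symmetrized product of the (in general non-commuting) operators `S i`, each taken
`s i` times: the average of the products over all orderings. -/
def symMonomial {U : TopologicalSpace.Opens (ℝ × ℝ)} {n : ℕ} (S : Fin n → Operator U)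
    (s : Fin n →₀ ℕ) : Operator U :=
  let l : List (Fin n) := (Finsupp.toMultiset s).sort (· ≤ ·)
  ((l.length.factorial : ℂ)⁻¹) • (l.permutations.map fun w => (w.map S).prod).sum

/-- The symmetrized value of a polynomial at a family of operators. -/
def symEval {U : TopologicalSpace.Opens (ℝ × ℝ)} {n : ℕ} (S : Fin n → Operator U)
    (P : MvPolynomial (Fin n) ℂ) : Operator U :=
  ∑ s ∈ P.support, P.coeff s • symMonomial S s

/-- Algebraic independence of operators: no nonzero polynomial vanishes on them when its
monomials are evaluated by symmetrized products. -/
def AlgIndep {U : TopologicalSpace.Opens (ℝ × ℝ)} {n : ℕ} (S : Fin n → Operator U) : Prop :=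
  ∀ P : MvPolynomial (Fin n) ℂ, symEval S P = 0 → P = 0

/-- (Maximal) superintegrability in two degrees of freedom: `H` belongs to a family of
`3 = 2 * 2 - 1` algebraically independent integrals of motion. -/
def Superintegrable (U : TopologicalSpace.Opens (ℝ × ℝ)) (H : Operator U) : Prop :=
  ∃ L K : Operator U, IsIntegral U H H ∧ IsIntegral U H L ∧ IsIntegral U H K ∧
    AlgIndep ![H, L, K]

/-! ### The seed -/

/-- The Jacobi polynomial
`P_n^{(a,b)}(x) = (a+1)_n / n! * ₂F₁(-n, n+a+b+1; a+1; (1-x)/2)`, with the denominators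
`(a+1)_k` cancelled, so that it is defined for all real `a`, `b`. -/
def jacobi (n : ℕ) (a b : ℝ) : Polynomial ℝ :=
  ∑ k ∈ Finset.range (n + 1),
    Polynomial.C ((ascPochhammer ℝ k).eval (n + a + b + 1) *
        (ascPochhammer ℝ (n - k)).eval (a + k + 1) / (k.factorial * (n - k).factorial)) *
      (Polynomial.C (1 / 2) * (Polynomial.X - 1)) ^ k

/-- The polynomial `P_m^{(-α-1, β-1)}`. -/
def seedPoly (m : ℕ) (α β : ℝ) : Polynomial ℝ := jacobi m (-α - 1) (β - 1)

/-- The seed `(1+x)^{β/2-1/4} (1-x)^{-α/2-1/4} P_m^{(-α-1, β-1)}(x)`. -/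
def seed (m : ℕ) (α β x : ℝ) : ℝ :=
  (1 + x) ^ (β / 2 - 1 / 4) * (1 - x) ^ (-α / 2 - 1 / 4) * (seedPoly m α β).eval x

/-- The function `W`, the logarithmic derivative of the seed. -/
def W (m : ℕ) (α β x : ℝ) : ℝ := logDeriv (seed m α β) x

/-- The variable `x = -cos 2θ`. -/
def xvar (θ : ℝ) : ℝ := -Real.cos (2 * θ)

/-- `w(θ) = 2 √(1-x²) W(x)` at `x = -cos 2θ`; for `0 < θ < π/2`, `√(1-x²) = sin 2θ`. -/
def w (m : ℕ) (α β θ : ℝ) : ℝ := 2 * Real.sin (2 * θ) * W m α β (xvar θ)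

/-- The angles `0 < θ < π/2` at which the seed polynomial does not vanish. -/
def angles (m : ℕ) (α β : ℝ) : Set ℝ :=
  {θ | 0 < θ ∧ θ < Real.pi / 2 ∧ (seedPoly m α β).eval (xvar θ) ≠ 0}

theorem isOpen_angles (m : ℕ) (α β : ℝ) : IsOpen (angles m α β) := by
  have h : Continuous fun θ : ℝ => (seedPoly m α β).eval (xvar θ) := by
    unfold xvar
    fun_prop
  exact (isOpen_lt continuous_const continuous_id).inter
    ((isOpen_lt continuous_id continuous_const).inter (isOpen_ne_fun h continuous_const))

/-- The configuration space in polar coordinates `p = (r, θ)`: the open quadrant without the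
rays on which the seed polynomial vanishes. -/
def dom (m : ℕ) (α β : ℝ) : TopologicalSpace.Opens (ℝ × ℝ) where
  carrier := {p | 0 < p.1 ∧ p.2 ∈ angles m α β}
  is_open' := (isOpen_lt continuous_const continuous_fst).inter
    ((isOpen_angles m α β).preimage continuous_snd)

theorem sin_pos_of_mem {m : ℕ} {α β θ : ℝ} (h : θ ∈ angles m α β) : 0 < Real.sin θ :=
  Real.sin_pos_of_pos_of_lt_pi h.1 (by linarith [h.2.1, Real.pi_pos])

theorem cos_pos_of_mem {m : ℕ} {α β θ : ℝ} (h : θ ∈ angles m α β) : 0 < Real.cos θ :=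
  Real.cos_pos_of_mem_Ioo ⟨by linarith [h.1, Real.pi_pos], h.2.1⟩

theorem contDiffOn_zpow_r (m : ℕ) (α β : ℝ) (n : ℤ) :
    ContDiffOn ℝ ∞ (fun p : ℝ × ℝ => p.1 ^ n) (dom m α β : Set (ℝ × ℝ)) := by
  intro p hp
  have hp1 : p.1 ≠ 0 := ne_of_gt hp.1
  refine ContDiffAt.contDiffWithinAt ?_
  cases n with
  | ofNat k => simpa using contDiffAt_fst.pow k
  | negSucc k =>
    simp only [zpow_negSucc]
    exact (contDiffAt_fst.pow (k + 1)).fun_inv (pow_ne_zero _ hp1)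

theorem contDiffOn_w (m : ℕ) (α β : ℝ) :
    ContDiffOn ℝ ∞ (fun p : ℝ × ℝ => w m α β p.2) (dom m α β : Set (ℝ × ℝ)) := by
  intro p hp
  refine ContDiffAt.contDiffWithinAt ?_
  have hs := sin_pos_of_mem hp.2
  have hc := cos_pos_of_mem hp.2
  have hsc := Real.sin_sq_add_cos_sq p.2
  have h2 : xvar p.2 = 1 - 2 * Real.cos p.2 ^ 2 := by
    unfold xvar
    rw [Real.cos_two_mul]
    ring
  have h1 : 0 < 1 + xvar p.2 := by nlinarith
  have h1' : 0 < 1 - xvar p.2 := by nlinarith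
  have hseed : ContDiffAt ℝ ∞ (seed m α β) (xvar p.2) := by
    unfold seed
    refine ((ContDiffAt.rpow_const_of_ne (by fun_prop) h1.ne').mul
      (ContDiffAt.rpow_const_of_ne (by fun_prop) h1'.ne')).mul ?_
    exact (Polynomial.contDiff_aeval (seedPoly m α β) ∞).contDiffAt
  have hne : seed m α β (xvar p.2) ≠ 0 :=
    mul_ne_zero (mul_ne_zero (Real.rpow_pos_of_pos h1 _).ne' (Real.rpow_pos_of_pos h1' _).ne')
      hp.2.2.2
  have hW : ContDiffAt ℝ ∞ (W m α β) (xvar p.2) := by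
    have hd : ContDiffAt ℝ ∞ (deriv (seed m α β)) (xvar p.2) :=
      (hseed.fderiv_right (m := ∞) (by simp)).clm_apply contDiffAt_const
    exact hd.div hseed hne
  have hx : ContDiffAt ℝ ∞ (fun q : ℝ × ℝ => xvar q.2) p := by
    unfold xvar
    fun_prop
  have hcomp : ContDiffAt ℝ ∞ (fun q : ℝ × ℝ => W m α β (xvar q.2)) p :=
    ContDiffAt.comp p hW hx
  unfold w
  exact ContDiffAt.mul (by fun_prop) hcomp

/-! ### The Hamiltonian and its integrals -/

section Operators

variable (m : ℕ) (α β : ℝ)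

/-- Multiplication by `r ^ n`. -/
def rPow (n : ℤ) : Operator (dom m α β) :=
  mulOp (dom m α β) (fun p => p.1 ^ n) (contDiffOn_zpow_r m α β n)

/-- Multiplication by `x = -cos 2θ`. -/
def opX : Operator (dom m α β) :=
  mulOp (dom m α β) (fun p => xvar p.2) (by unfold xvar; fun_prop)

/-- Multiplication by `cos θ`. -/
def cosθ : Operator (dom m α β) :=
  mulOp (dom m α β) (fun p => Real.cos p.2) (by fun_prop)

/-- Multiplication by `sin θ`. -/
def sinθ : Operator (dom m α β) :=
  mulOp (dom m α β) (fun p => Real.sin p.2) (by fun_prop)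

/-- Multiplication by `sin 2θ`. -/
def sin2θ : Operator (dom m α β) :=
  mulOp (dom m α β) (fun p => Real.sin (2 * p.2)) (by fun_prop)

/-- Multiplication by `w(θ)`. -/
def opw : Operator (dom m α β) :=
  mulOp (dom m α β) (fun p => w m α β p.2) (contDiffOn_w m α β)

/-- `A = 2√(1-x²) (d/dx - W(x)) = ∂_θ - w(θ)`. -/
def A : Operator (dom m α β) := dθ (dom m α β) - opw m α β

/-- `A† = 2√(1-x²) (-d/dx - W(x)) = -∂_θ - w(θ)`. -/
def Adag : Operator (dom m α β) := -dθ (dom m α β) - opw m α β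

/-- The additive constant `(2m - α + β - 1)²` of the factorization. -/
def shift : ℝ := (2 * m - α + β - 1) ^ 2

/-- The second-order operator `L₂ = L⁽²⁾ = A A† + (2m - α + β - 1)²`. -/
def L2 : Operator (dom m α β) := A m α β * Adag m α β + (shift m α β : ℂ) • 1

/-- The Hamiltonian
`H = -(1/(2r)) ∂_r r ∂_r + (1/2) freq² r² + (1/(2r²)) L⁽²⁾`. -/
def H (freq : ℝ) : Operator (dom m α β) :=
  -((1 / 2 : ℂ) • (rPow m α β (-1) * dr (dom m α β) * rPow m α β 1 * dr (dom m α β)))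
    + ((1 / 2 : ℂ) * (freq : ℂ) ^ 2) • rPow m α β 2
    + (1 / 2 : ℂ) • (rPow m α β (-2) * L2 m α β)

/-- The operator `2(1-x²) d/dx = sin 2θ ∂_θ`. -/
def opS : Operator (dom m α β) := sin2θ m α β * dθ (dom m α β)

/-- The constant `(α+β)(α-β+2)`. -/
def delta : ℝ := (α + β) * (α - β + 2)

/-- The operator `L₄`, given by
`2 L₄ = A (2(1-x²) ∂_x) A† (1/r² - (1/r) ∂_r) + A x A† ((1/r) ∂_r - L₂/r² + H)
  - ((α+β)(α-β+2)/r²) A A†`. -/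
def L4 (freq : ℝ) : Operator (dom m α β) :=
  (1 / 2 : ℂ) •
    (A m α β * opS m α β * Adag m α β * (rPow m α β (-2) - rPow m α β (-1) * dr (dom m α β))
      + A m α β * opX m α β * Adag m α β *
          (rPow m α β (-1) * dr (dom m α β) - rPow m α β (-2) * L2 m α β + H m α β freq)
      - (delta α β : ℂ) • (rPow m α β (-2) * (A m α β * Adag m α β)))

/-- The ladder operators of the Jacobi functions,
`b_Λ = 2(1-Λ)(1-x²) ∂_x + Λ(1-Λ) x - (α+β)(α-β+2)`. -/
def bLadder (Λ : ℂ) : Operator (dom m α β) :=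
  (1 - Λ) • opS m α β + (Λ * (1 - Λ)) • opX m α β - (delta α β : ℂ) • 1

/-- The conjugated angular ladder operators `B_Λ = A b_Λ A†`. -/
def BLadder (Λ : ℂ) : Operator (dom m α β) := A m α β * bLadder m α β Λ * Adag m α β

/-- The radial (conjugated Laguerre) ladder operators
`C_{Λ,E} = ((Λ+1)/r) ∂_r - Λ(Λ+1)/r² + E`. -/
def CLadder (Λ E : ℂ) : Operator (dom m α β) :=
  (Λ + 1) • (rPow m α β (-1) * dr (dom m α β)) - (Λ * (Λ + 1)) • rPow m α β (-2) + E • 1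

/-- The Cartesian derivative `p₁ = ∂/∂x₁ = cos θ ∂_r - (sin θ / r) ∂_θ`
(`x₁ = r cos θ`, `x₂ = r sin θ`). -/
def p1 : Operator (dom m α β) :=
  cosθ m α β * dr (dom m α β) - sinθ m α β * rPow m α β (-1) * dθ (dom m α β)

/-- The Cartesian derivative `p₂ = ∂/∂x₂ = sin θ ∂_r + (cos θ / r) ∂_θ`. -/
def p2 : Operator (dom m α β) :=
  sinθ m α β * dr (dom m α β) + cosθ m α β * rPow m α β (-1) * dθ (dom m α β)

end Operators

/-- The trigonometric potential `(α² - 1/4)/cos² θ + (β² - 1/4)/sin² θ`. -/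
def trigPotential (α β θ : ℝ) : ℝ :=
  (α ^ 2 - 1 / 4) / Real.cos θ ^ 2 + (β ^ 2 - 1 / 4) / Real.sin θ ^ 2

/-- The rationally extended potential
`(α² - 1/4)/cos² θ + (β² - 1/4)/sin² θ - 2 (d²/dθ²) log |P_m^{(-α-1, β-1)}(-cos 2θ)|`. -/
def extPotential (m : ℕ) (α β θ : ℝ) : ℝ :=
  trigPotential α β θ -
    2 * deriv (deriv fun t => Real.log |(seedPoly m α β).eval (xvar t)|) θ

/-- The radial operator `-(1/(2r)) ∂_r r ∂_r + (1/2) freq² r² + λ/(2r²)`. -/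
def radial (freq : ℝ) (lam : ℂ) (R : ℝ → ℂ) (r : ℝ) : ℂ :=
  -(1 / (2 * (r : ℂ))) * deriv (fun s : ℝ => (s : ℂ) * deriv R s) r
    + (1 / 2 : ℂ) * (freq : ℂ) ^ 2 * (r : ℂ) ^ 2 * R r + lam / (2 * (r : ℂ) ^ 2) * R r

end

end RosenMorse

/-! In the variable θ, `w` is the logarithmic derivative of the seed φ, so `A` annihilates φ. The
Jacobi equation says that φ is a formal eigenfunction of a trigonometric Schrödinger operator, the
partner of `L2`. This is the Riccati equation `riccati`: w' + w² + shift is a pure trigonometric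
potential. Hence A†A = -∂² + w² + w' contains no trace of the polynomial, while AA† = -∂² + w² - w'
is its rational extension.

For commutation, let T = `partner`, x = `opX`, S = `opS`. The commutators [T, x] and [T, S] close on
x, S, xT and 1 (`partner_mul_opX`, `partner_mul_opS`). On the eigenspace T = Λ² this makes `bLadder`
a ladder operator: [T, b_Λ] = 4(1 - Λ) b_Λ there, which takes Λ² to (Λ - 2)². Since L₂A = AT and TA†
= A†L₂, the map X ↦ AXA† carries the relations over to `L2`; the constant 1 becomes AA†. Everything
radial is generated by powers of r and E = (1/r)∂_r. With these relations [H, L₄] = 0 is a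
normal-ordering computation in an abstract ring, `commute_of_ladder_relations`. The ladder form of
`L4` is then a comparison of coefficients on a joint eigenspace.

Orders, leading terms and independence all come from principal symbols. Conjugating an operator of
order k by exp(t(ar + bθ)) gives a polynomial in t of degree at most k, whose coefficient of t^k is
the symbol. Symbols are multiplicative and do not see the ordering of factors. So the top
weighted-homogeneous part of a polynomial relation between operators is a relation between symbols
(`algIndep_of_hasSymbol`). The symbols of H, L₂, L₄ fill a box in three-dimensional real space
(`eq_zero_of_eval_symbols`), so no such relation exists. Two fourth-order operators with the same
symbol differ by one of order three, which gives the leading term. -/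

namespace RosenMorse

noncomputable section

section


/-! ### Smooth functions as multiplication operators, and the Leibniz rule -/

variable {U : TopologicalSpace.Opens (ℝ × ℝ)}

/-- The ring structure on `Operator U`, as a local instance that unification finds at once. -/
@[reducible] def operatorRing (U : TopologicalSpace.Opens (ℝ × ℝ)) : Ring (Operator U) :=
  Module.End.instRing

theorem Smooth.ext_on {f g : Smooth U} (h : ∀ p ∈ U, (f : ℝ × ℝ → ℂ) p = (g : ℝ × ℝ → ℂ) p) :
    f = g := by
  ext p
  by_cases hp : p ∈ U
  · exact h p hp
  · rw [f.2.2 p hp, g.2.2 p hp]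

theorem Operator.ext_on {X Y : Operator U}
    (h : ∀ (f : Smooth U), ∀ p ∈ U, (X f : ℝ × ℝ → ℂ) p = (Y f : ℝ × ℝ → ℂ) p) : X = Y :=
  LinearMap.ext fun f => Smooth.ext_on (h f)

/-- The element of `C^∞(U)` given by a function smooth on `U`. -/
def ofFun (g : ℝ × ℝ → ℂ) (hg : ContDiffOn ℝ ∞ g (U : Set (ℝ × ℝ))) : Smooth U :=
  ⟨(U : Set (ℝ × ℝ)).indicator g, indicator_mem_smooth hg⟩

theorem ofFun_apply {g : ℝ × ℝ → ℂ} (hg : ContDiffOn ℝ ∞ g (U : Set (ℝ × ℝ))) {p : ℝ × ℝ}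
    (hp : p ∈ U) : (ofFun g hg : ℝ × ℝ → ℂ) p = g p :=
  Set.indicator_of_mem (s := (U : Set (ℝ × ℝ))) hp g

/-- Multiplication by an element of `C^∞(U)`. -/
def mulC : Smooth U →ₗ[ℂ] Operator U :=
  LinearMap.mk₂ ℂ (fun a f => ⟨fun p => (a : ℝ × ℝ → ℂ) p * (f : ℝ × ℝ → ℂ) p,
      a.2.1.mul f.2.1, fun p hp => by simp [f.2.2 p hp]⟩)
    (fun a b f => by ext p; simp [add_mul])
    (fun c a f => by ext p; simp [mul_assoc])
    (fun a f g => by ext p; simp [mul_add])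
    (fun c a f => by ext p; simp; ring)

theorem mulC_apply (a f : Smooth U) (p : ℝ × ℝ) :
    (mulC a f : ℝ × ℝ → ℂ) p = (a : ℝ × ℝ → ℂ) p * (f : ℝ × ℝ → ℂ) p := rfl

theorem mulOp_apply {g : ℝ × ℝ → ℝ} (hg : ContDiffOn ℝ ∞ g (U : Set (ℝ × ℝ))) (f : Smooth U)
    (p : ℝ × ℝ) : (mulOp U g hg f : ℝ × ℝ → ℂ) p = (g p : ℂ) * (f : ℝ × ℝ → ℂ) p := by
  simp [mulOp]

theorem dirDeriv_apply (v : ℝ × ℝ) (f : Smooth U) {p : ℝ × ℝ} (hp : p ∈ U) :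
    (dirDeriv U v f : ℝ × ℝ → ℂ) p = fderiv ℝ (f : ℝ × ℝ → ℂ) p v :=
  Set.indicator_of_mem (s := (U : Set (ℝ × ℝ))) hp fun q => fderiv ℝ (f : ℝ × ℝ → ℂ) q v

theorem ContDiffOn.ofReal {g : ℝ × ℝ → ℝ} {s : Set (ℝ × ℝ)} (hg : ContDiffOn ℝ ∞ g s) :
    ContDiffOn ℝ ∞ (fun p => (g p : ℂ)) s :=
  Complex.ofRealCLM.contDiff.comp_contDiffOn hg

theorem mulOp_eq_mulC {g : ℝ × ℝ → ℝ} (hg : ContDiffOn ℝ ∞ g (U : Set (ℝ × ℝ))) :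
    mulOp U g hg =
      mulC (ofFun (fun p => (g p : ℂ)) (ContDiffOn.ofReal hg)) :=
  Operator.ext_on fun f p hp => by rw [mulOp_apply, mulC_apply, ofFun_apply _ hp]

theorem mulC_mul_comm (a b : Smooth U) : mulC a * mulC b = mulC b * mulC a :=
  Operator.ext_on fun f p _ => by simp only [Module.End.mul_apply, mulC_apply]; ring

theorem mulC_mul (a b : Smooth U) : mulC a * mulC b = mulC (mulC a b) :=
  Operator.ext_on fun f p _ => by simp only [Module.End.mul_apply, mulC_apply]; ring

theorem dirDeriv_mul_mulC (v : ℝ × ℝ) (a : Smooth U) :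
    dirDeriv U v * mulC a = mulC a * dirDeriv U v + mulC (dirDeriv U v a) :=
  Operator.ext_on fun f p hp => by
    simp only [Module.End.mul_apply, LinearMap.add_apply, Submodule.coe_add, Pi.add_apply,
      mulC_apply, dirDeriv_apply _ _ hp]
    have h : ((mulC a f : Smooth U) : ℝ × ℝ → ℂ) =
        fun q => (a : ℝ × ℝ → ℂ) q * (f : ℝ × ℝ → ℂ) q := rfl
    rw [h, fderiv_fun_mul (Smooth.differentiableAt a hp) (Smooth.differentiableAt f hp)]
    simp only [add_apply, smul_apply, smul_eq_mul]
    ring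

/-- The Leibniz rule at a point. The derivative of the multiplier is only asked for along the line p
+ tv, so that one-variable derivatives in r or θ can be supplied directly. -/
theorem dirDeriv_mulOp_apply (v : ℝ × ℝ) {g : ℝ × ℝ → ℝ}
    (hg : ContDiffOn ℝ ∞ g (U : Set (ℝ × ℝ))) {g' : ℝ} {p : ℝ × ℝ} (hp : p ∈ U)
    (h : HasDerivAt (fun t : ℝ => g (p + t • v)) g' 0) (f : Smooth U) :
    (dirDeriv U v (mulOp U g hg f) : ℝ × ℝ → ℂ) p =
      g p * (dirDeriv U v f : ℝ × ℝ → ℂ) p + g' * (f : ℝ × ℝ → ℂ) p := by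
  rw [mulOp_eq_mulC hg, ← Module.End.mul_apply, dirDeriv_mul_mulC]
  simp only [Module.End.mul_apply, LinearMap.add_apply, Submodule.coe_add, Pi.add_apply,
    mulC_apply, ofFun_apply _ hp]
  congr 2
  rw [dirDeriv_apply _ _ hp]
  set F := ofFun (U := U) (fun p => (g p : ℂ)) (ContDiffOn.ofReal hg)
  have hF := (Smooth.differentiableAt F hp).hasFDerivAt
  have hl : HasDerivAt (fun t : ℝ => p + t • v) v 0 := by
    simpa using ((hasDerivAt_id (0 : ℝ)).smul_const v).const_add p
  have h1 : HasDerivAt (fun t : ℝ => (F : ℝ × ℝ → ℂ) (p + t • v))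
      (fderiv ℝ (F : ℝ × ℝ → ℂ) p v) 0 :=
    HasFDerivAt.comp_hasDerivAt (0 : ℝ) (by simpa using hF) hl
  refine h1.unique (h.ofReal_comp.congr_of_eventuallyEq ?_)
  -- `F` is cut off to zero outside `U`; it agrees with `g` near t = 0 because `U` is open.
  have : ∀ᶠ t : ℝ in nhds 0, p + t • v ∈ U :=
    hl.continuousAt.eventually_mem (U.isOpen.mem_nhds (by simpa using hp))
  filter_upwards [this] with t ht
  exact ofFun_apply _ ht

theorem dr_mulOp_apply {g : ℝ × ℝ → ℝ} (hg : ContDiffOn ℝ ∞ g (U : Set (ℝ × ℝ))) {g' : ℝ}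
    {p : ℝ × ℝ} (hp : p ∈ U) (h : HasDerivAt (fun t : ℝ => g (t, p.2)) g' p.1) (f : Smooth U) :
    (dr U (mulOp U g hg f) : ℝ × ℝ → ℂ) p =
      g p * (dr U f : ℝ × ℝ → ℂ) p + g' * (f : ℝ × ℝ → ℂ) p := by
  refine dirDeriv_mulOp_apply (1, 0) hg hp ?_ f
  have := HasDerivAt.comp_const_add p.1 (0 : ℝ) (f := fun t : ℝ => g (t, p.2)) (by simpa using h)
  simpa [Prod.add_def] using this

theorem dθ_mulOp_apply {g : ℝ × ℝ → ℝ} (hg : ContDiffOn ℝ ∞ g (U : Set (ℝ × ℝ))) {g' : ℝ}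
    {p : ℝ × ℝ} (hp : p ∈ U) (h : HasDerivAt (fun t : ℝ => g (p.1, t)) g' p.2) (f : Smooth U) :
    (dθ U (mulOp U g hg f) : ℝ × ℝ → ℂ) p =
      g p * (dθ U f : ℝ × ℝ → ℂ) p + g' * (f : ℝ × ℝ → ℂ) p := by
  refine dirDeriv_mulOp_apply (0, 1) hg hp ?_ f
  have := HasDerivAt.comp_const_add p.2 (0 : ℝ) (f := fun t : ℝ => g (p.1, t)) (by simpa using h)
  simpa [Prod.add_def] using this

theorem mulOp_mul_mulOp {g h : ℝ × ℝ → ℝ} (hg : ContDiffOn ℝ ∞ g (U : Set (ℝ × ℝ)))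
    (hh : ContDiffOn ℝ ∞ h (U : Set (ℝ × ℝ))) :
    mulOp U g hg * mulOp U h hh = mulOp U h hh * mulOp U g hg := by
  rw [mulOp_eq_mulC, mulOp_eq_mulC, mulC_mul_comm]

/-- Both sides are values of the second Fréchet derivative, which is symmetric. -/
theorem dirDeriv_comm (v u : ℝ × ℝ) : dirDeriv U v * dirDeriv U u = dirDeriv U u * dirDeriv U v :=
  Operator.ext_on fun f p hp => by
    have key : ∀ v u : ℝ × ℝ, ((dirDeriv U v * dirDeriv U u) f : ℝ × ℝ → ℂ) p =
        fderiv ℝ (fderiv ℝ (f : ℝ × ℝ → ℂ)) p v u := by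
      intro v u
      rw [Module.End.mul_apply, dirDeriv_apply _ _ hp]
      have he : (dirDeriv U u f : ℝ × ℝ → ℂ) =ᶠ[nhds p]
          fun q => fderiv ℝ (f : ℝ × ℝ → ℂ) q u := by
        filter_upwards [U.isOpen.mem_nhds hp] with q hq using dirDeriv_apply u f hq
      rw [he.fderiv_eq]
      have hd : DifferentiableAt ℝ (fderiv ℝ (f : ℝ × ℝ → ℂ)) p :=
        (((f.2.1.fderiv_of_isOpen (m := ∞) U.isOpen (by simp)).contDiffAt
          (U.isOpen.mem_nhds hp)).differentiableAt (by simp))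
      rw [fderiv_clm_apply hd (by fun_prop)]
      simp
    rw [key, key]
    exact ((f.2.1.contDiffAt (U.isOpen.mem_nhds hp)).isSymmSndFDerivAt
      (by simpa using WithTop.coe_le_coe.2 (le_top (a := (2 : ℕ∞))))) v u

/-! ### Differential operators of bounded order -/

/-- The differential operators of order at most `k`, in normal form. -/
def diffOps (U : TopologicalSpace.Opens (ℝ × ℝ)) (k : ℕ) : Submodule ℂ (Operator U) :=
  Submodule.span ℂ {X | ∃ (a : Smooth U) (i j : ℕ), i + j ≤ k ∧ X = mulC a * (dr U ^ i * dθ U ^ j)}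

theorem monomial_mem_diffOps {k i j : ℕ} (a : Smooth U) (h : i + j ≤ k) :
    mulC a * (dr U ^ i * dθ U ^ j) ∈ diffOps U k :=
  Submodule.subset_span ⟨a, i, j, h, rfl⟩

theorem diffOps_mono {k l : ℕ} (h : k ≤ l) : diffOps U k ≤ diffOps U l :=
  Submodule.span_mono fun _ ⟨a, i, j, hij, hX⟩ => ⟨a, i, j, hij.trans h, hX⟩

theorem mulC_mul_mem_diffOps {k : ℕ} (b : Smooth U) {X : Operator U} (hX : X ∈ diffOps U k) :
    mulC b * X ∈ diffOps U k := by
  induction hX using Submodule.span_induction with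
  | mem X h =>
    obtain ⟨a, i, j, h, rfl⟩ := h
    rw [← mul_assoc, mulC_mul]
    exact monomial_mem_diffOps _ h
  | zero => simp
  | add X Y _ _ hX hY => rw [mul_add]; exact add_mem hX hY
  | smul c X _ hX => rw [mul_smul_comm]; exact Submodule.smul_mem _ _ hX

theorem dr_mul_mem_diffOps {k : ℕ} {X : Operator U} (hX : X ∈ diffOps U k) :
    dr U * X ∈ diffOps U (k + 1) := by
  induction hX using Submodule.span_induction with
  | mem X h =>
    obtain ⟨a, i, j, h, rfl⟩ := h
    rw [← mul_assoc, dr, dirDeriv_mul_mulC, add_mul, mul_assoc, ← mul_assoc (dirDeriv U _),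
      ← pow_succ']
    exact add_mem (monomial_mem_diffOps (i := i + 1) _ (by omega))
      (monomial_mem_diffOps _ (by omega))
  | zero => simp
  | add X Y _ _ hX hY => rw [mul_add]; exact add_mem hX hY
  | smul c X _ hX => rw [mul_smul_comm]; exact Submodule.smul_mem _ _ hX

theorem dr_dθ_commute : Commute (dr U) (dθ U) := dirDeriv_comm _ _

theorem dθ_mul_mem_diffOps {k : ℕ} {X : Operator U} (hX : X ∈ diffOps U k) :
    dθ U * X ∈ diffOps U (k + 1) := by
  induction hX using Submodule.span_induction with
  | mem X h =>
    obtain ⟨a, i, j, h, rfl⟩ := h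
    have hc : dθ U * (dr U ^ i * dθ U ^ j) = dr U ^ i * dθ U ^ (j + 1) := by
      rw [← mul_assoc, ((dr_dθ_commute.pow_left i).eq).symm, mul_assoc, ← pow_succ']
    have : dθ U * (mulC a * (dr U ^ i * dθ U ^ j)) =
        mulC a * (dr U ^ i * dθ U ^ (j + 1)) + mulC (dθ U a) * (dr U ^ i * dθ U ^ j) := by
      rw [← hc, ← mul_assoc, dθ, dirDeriv_mul_mulC, add_mul, mul_assoc]
    rw [this]
    exact add_mem (monomial_mem_diffOps _ (by omega)) (monomial_mem_diffOps _ (by omega))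
  | zero => simp
  | add X Y _ _ hX hY => rw [mul_add]; exact add_mem hX hY
  | smul c X _ hX => rw [mul_smul_comm]; exact Submodule.smul_mem _ _ hX

/-- For a monomial `X`, its derivatives are applied to `Y` one at a time; by the Leibniz rule each
costs at most one order, and the coefficient costs none. -/
theorem mul_mem_diffOps {k l : ℕ} {X Y : Operator U} (hX : X ∈ diffOps U k)
    (hY : Y ∈ diffOps U l) : X * Y ∈ diffOps U (k + l) := by
  induction hX using Submodule.span_induction with
  | mem X h =>
    obtain ⟨a, i, j, h, rfl⟩ := h
    rw [mul_assoc]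
    refine mulC_mul_mem_diffOps a (diffOps_mono (k := i + (j + l)) (by omega) ?_)
    have hj : dθ U ^ j * Y ∈ diffOps U (j + l) := by
      clear h
      induction j with
      | zero => simpa using hY
      | succ j ih =>
        rw [pow_succ', mul_assoc]
        exact diffOps_mono (by omega) (dθ_mul_mem_diffOps ih)
    rw [mul_assoc]
    clear h
    induction i with
    | zero => simpa using hj
    | succ i ih =>
      rw [pow_succ', mul_assoc]
      exact diffOps_mono (by omega) (dr_mul_mem_diffOps ih)
  | zero => simp
  | add X Y _ _ hX hY => rw [add_mul]; exact add_mem hX hY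
  | smul c X _ hX => rw [smul_mul_assoc]; exact Submodule.smul_mem _ _ hX

theorem mulC_one : mulC (ofFun (U := U) (fun _ => 1) contDiffOn_const) = 1 :=
  Operator.ext_on fun f p hp => by rw [mulC_apply, ofFun_apply _ hp, one_mul]; rfl

theorem one_mem_diffOps : (1 : Operator U) ∈ diffOps U 0 := by
  simpa [mulC_one] using
    monomial_mem_diffOps (k := 0) (i := 0) (j := 0) (ofFun (U := U) (fun _ => 1) contDiffOn_const)
      le_rfl

theorem dr_mem_diffOps : dr U ∈ diffOps U 1 := by
  simpa using dr_mul_mem_diffOps one_mem_diffOps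

theorem dθ_mem_diffOps : dθ U ∈ diffOps U 1 := by
  simpa using dθ_mul_mem_diffOps one_mem_diffOps

theorem mulOp_mem_diffOps {g : ℝ × ℝ → ℝ} (hg : ContDiffOn ℝ ∞ g (U : Set (ℝ × ℝ))) :
    mulOp U g hg ∈ diffOps U 0 := by
  rw [mulOp_eq_mulC]
  simpa using mulC_mul_mem_diffOps _ one_mem_diffOps

/-- An operator in `diffOps U k` as a finite sum of monomials. -/
theorem exists_eq_sum_of_mem_diffOps {k : ℕ} {X : Operator U} (hX : X ∈ diffOps U k) :
    ∃ a : ℕ → ℕ → Smooth U, X = ∑ i ∈ Finset.range (k + 1), ∑ j ∈ Finset.range (k + 1 - i),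
      mulC (a i j) * (dr U ^ i * dθ U ^ j) := by
  induction hX using Submodule.span_induction with
  | mem X h =>
    obtain ⟨a, i, j, h, rfl⟩ := h
    refine ⟨fun i' j' => if i' = i ∧ j' = j then a else 0, ?_⟩
    rw [Finset.sum_eq_single i, Finset.sum_eq_single j]
    · simp
    · intro j' _ hj'
      simp [hj']
    · intro hj
      exact absurd (Finset.mem_range.2 (by omega)) hj
    · intro i' _ hi'
      simp [hi']
    · intro hi
      exact absurd (Finset.mem_range.2 (by omega)) hi
  | zero => exact ⟨0, by simp⟩
  | add X Y _ _ hX hY =>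
    obtain ⟨a, rfl⟩ := hX
    obtain ⟨b, rfl⟩ := hY
    exact ⟨a + b, by simp [add_mul, Finset.sum_add_distrib]⟩
  | smul c X _ hX =>
    obtain ⟨a, rfl⟩ := hX
    exact ⟨c • a, by simp [Finset.smul_sum]⟩

theorem isDiffOp_sum_monomial {k : ℕ} (a : ℕ → ℕ → Smooth U) :
    IsDiffOp U k (∑ i ∈ Finset.range (k + 1), ∑ j ∈ Finset.range (k + 1 - i),
      mulC (a i j) * (dr U ^ i * dθ U ^ j)) :=
  ⟨fun i j => a i j, fun i j => (a i j).2.1, fun f p _ => by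
    simp only [LinearMap.sum_apply, Submodule.coe_sum, Finset.sum_apply, Module.End.mul_apply,
      mulC_apply]⟩

theorem isDiffOp_of_mem_diffOps {k : ℕ} {X : Operator U} (hX : X ∈ diffOps U k) :
    IsDiffOp U k X := by
  obtain ⟨a, rfl⟩ := exists_eq_sum_of_mem_diffOps hX
  exact isDiffOp_sum_monomial a

end

section


/-! ### The Jacobi differential equation -/

/-- The coefficients of the Jacobi polynomial in powers of `(x-1)/2`. -/
def jacobiCoeff (n : ℕ) (a b : ℝ) (k : ℕ) : ℝ :=
  if k ∈ Finset.range (n + 1) then (ascPochhammer ℝ k).eval (n + a + b + 1) *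
    (ascPochhammer ℝ (n - k)).eval (a + k + 1) / (k.factorial * (n - k).factorial) else 0

/-- The hypergeometric two-term recurrence, cleared of denominators so that it also holds when k + 1
+ a = 0. At k = n it encodes the termination of the series. -/
theorem jacobiCoeff_succ (n : ℕ) (a b : ℝ) (k : ℕ) :
    (k + 1) * (k + 1 + a) * jacobiCoeff n a b (k + 1) =
      (n - k) * (n + k + a + b + 1) * jacobiCoeff n a b k := by
  unfold jacobiCoeff
  rcases lt_trichotomy k n with h | rfl | h
  · obtain ⟨d, rfl⟩ := Nat.exists_eq_add_of_lt h
    rw [if_pos (by simp), if_pos (by simp; omega)]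
    rw [show k + d + 1 - (k + 1) = d by omega, show k + d + 1 - k = d + 1 by omega,
      ascPochhammer_succ_eval, ascPochhammer_succ_left, Polynomial.eval_mul,
      Polynomial.eval_comp]
    -- Matches the shifted argument produced by (y)_{d+1} = y (y+1)_d at y = a + k + 1.
    have e : (a + ((k + 1 : ℕ) : ℝ) + 1) = Polynomial.eval (a + k + 1) (Polynomial.X + 1) := by
      simp; ring
    rw [e, Nat.factorial_succ, Nat.factorial_succ]
    have h1 : (k.factorial : ℝ) ≠ 0 := by positivity
    have h2 : (d.factorial : ℝ) ≠ 0 := by positivity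
    push_cast
    simp only [Polynomial.eval_X]
    field_simp
    ring
  · simp
  · rw [if_neg (by simp; omega), if_neg (by simp; omega)]
    simp

/-- The Jacobi polynomial in the variable `(x-1)/2`. -/
def jacobiShifted (n : ℕ) (a b : ℝ) : Polynomial ℝ :=
  ∑ k ∈ Finset.range (n + 1), Polynomial.monomial k (jacobiCoeff n a b k)

theorem coeff_jacobiShifted (n : ℕ) (a b : ℝ) (k : ℕ) :
    (jacobiShifted n a b).coeff k = jacobiCoeff n a b k := by
  simp only [jacobiShifted, Polynomial.finsetSum_coeff, Polynomial.coeff_monomial]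
  rw [Finset.sum_ite_eq' (Finset.range (n + 1)) k]
  split_ifs with h
  · rfl
  · rw [jacobiCoeff, if_neg h]

theorem jacobi_eq_comp (n : ℕ) (a b : ℝ) :
    jacobi n a b =
      (jacobiShifted n a b).comp (Polynomial.C (1 / 2) * (Polynomial.X - 1)) := by
  rw [jacobi, jacobiShifted, ← Polynomial.coe_compRingHom_apply, map_sum]
  refine Finset.sum_congr rfl fun k hk => ?_
  rw [Polynomial.coe_compRingHom_apply, Polynomial.monomial_comp, jacobiCoeff, if_pos hk]

open Polynomial in
-- The coefficient of y^k in the equation is exactly the recurrence for the coefficients; k = 0 and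
-- k = 1 are separate only because the factors X and X² shift indices.
theorem jacobiShifted_ode (n : ℕ) (a b : ℝ) :
    X ^ 2 * derivative (derivative (jacobiShifted n a b)) +
      X * derivative (derivative (jacobiShifted n a b)) +
      C (a + 1) * derivative (jacobiShifted n a b) +
      C (a + b + 2) * (X * derivative (jacobiShifted n a b)) -
      C (n * (n + a + b + 1)) * jacobiShifted n a b = 0 := by
  ext k
  have hrec := jacobiCoeff_succ n a b k
  rw [pow_two, mul_assoc]
  simp only [coeff_add, coeff_sub, coeff_C_mul, coeff_zero]
  rcases k with - | - | k
  · simp only [mul_coeff_zero, coeff_X_zero, coeff_derivative, coeff_jacobiShifted] at hrec ⊢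
    push_cast at hrec ⊢
    linear_combination hrec
  · simp only [coeff_X_mul, mul_coeff_zero, coeff_X_zero, coeff_derivative,
      coeff_jacobiShifted] at hrec ⊢
    push_cast at hrec ⊢
    linear_combination hrec
  · simp only [coeff_X_mul, coeff_derivative, coeff_jacobiShifted] at hrec ⊢
    push_cast at hrec ⊢
    linear_combination hrec

open Polynomial in
/-- The Jacobi differential equation. -/
theorem jacobi_ode (n : ℕ) (a b x : ℝ) :
    (1 - x ^ 2) * (derivative (derivative (jacobi n a b))).eval x +
      (b - a - (a + b + 2) * x) * (derivative (jacobi n a b)).eval x +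
      n * (n + a + b + 1) * (jacobi n a b).eval x = 0 := by
  have h := congrArg (eval ((x - 1) / 2)) (jacobiShifted_ode n a b)
  have hl : derivative (C (1 / 2 : ℝ) * (X - 1)) = C (1 / 2) := by simp
  have hx : (1 / 2) * (x - 1) = (x - 1) / 2 := by ring
  simp only [jacobi_eq_comp, derivative_comp, derivative_mul, hl, derivative_C, eval_comp, eval_mul,
    eval_add, eval_sub, eval_pow, eval_X, eval_C, eval_zero, eval_one, hx] at h ⊢
  -- With y = (x - 1)/2 one has (1 - x²)∂_x² = -y(y + 1)∂_y², whence the sign.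
  linear_combination -h

/-! ### The superpotential -/

variable {m : ℕ} {α β : ℝ}

theorem xvar_eq (θ : ℝ) : xvar θ = Real.sin θ ^ 2 - Real.cos θ ^ 2 := by
  rw [xvar, Real.cos_two_mul']
  ring

theorem W_eq {x : ℝ} (h1 : 0 < 1 + x) (h2 : 0 < 1 - x) (hP : (seedPoly m α β).eval x ≠ 0) :
    W m α β x = (β / 2 - 1 / 4) / (1 + x) + (α / 2 + 1 / 4) / (1 - x) +
      (Polynomial.derivative (seedPoly m α β)).eval x / (seedPoly m α β).eval x := by
  have d1 : HasDerivAt (fun x : ℝ => (1 + x) ^ (β / 2 - 1 / 4))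
      (1 * (β / 2 - 1 / 4) * (1 + x) ^ (β / 2 - 1 / 4 - 1)) x :=
    ((hasDerivAt_id x).const_add 1).rpow_const (Or.inl h1.ne')
  have d2 : HasDerivAt (fun x : ℝ => (1 - x) ^ (-α / 2 - 1 / 4))
      (-1 * (-α / 2 - 1 / 4) * (1 - x) ^ (-α / 2 - 1 / 4 - 1)) x :=
    ((hasDerivAt_id x).const_sub 1).rpow_const (Or.inl h2.ne')
  have d3 := (seedPoly m α β).hasDerivAt x
  have d := (d1.mul d2).mul d3
  have e1 := (Real.rpow_pos_of_pos h1 (β / 2 - 1 / 4)).ne'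
  have e2 := (Real.rpow_pos_of_pos h2 (-α / 2 - 1 / 4)).ne'
  have hd : deriv (seed m α β) x = _ := d.deriv
  rw [W, logDeriv_apply, hd, Real.rpow_sub_one h1.ne', Real.rpow_sub_one h2.ne', seed]
  simp only [Pi.mul_apply]
  field_simp
  ring

/-- The values at `θ` of the logarithmic derivatives of the seed polynomial. -/
def polyRatio (m : ℕ) (α β : ℝ) (k : ℕ) (θ : ℝ) : ℝ :=
  (Polynomial.derivative^[k] (seedPoly m α β)).eval (xvar θ) / (seedPoly m α β).eval (xvar θ)

theorem w_eq {θ : ℝ} (h : θ ∈ angles m α β) :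
    w m α β θ = (β - 1 / 2) * (Real.cos θ / Real.sin θ) +
      (α + 1 / 2) * (Real.sin θ / Real.cos θ) +
      2 * Real.sin (2 * θ) * polyRatio m α β 1 θ := by
  have hs := sin_pos_of_mem h
  have hc := cos_pos_of_mem h
  have hsc := Real.sin_sq_add_cos_sq θ
  have h1 : 1 + xvar θ = 2 * Real.sin θ ^ 2 := by rw [xvar_eq]; linear_combination -hsc
  have h2 : 1 - xvar θ = 2 * Real.cos θ ^ 2 := by rw [xvar_eq]; linear_combination -hsc
  rw [w, W_eq (by rw [h1]; positivity) (by rw [h2]; positivity) h.2.2, h1, h2, polyRatio,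
    Real.sin_two_mul, Function.iterate_one]
  have := h.2.2
  field_simp
  ring

theorem hasDerivAt_xvar (θ : ℝ) : HasDerivAt xvar (2 * Real.sin (2 * θ)) θ := by
  have : HasDerivAt xvar (-(-Real.sin (2 * θ) * (2 * 1))) θ :=
    (((hasDerivAt_id θ).const_mul 2).cos).neg
  convert this using 1
  ring

theorem hasDerivAt_polyRatio {θ : ℝ} (h : θ ∈ angles m α β) :
    HasDerivAt (polyRatio m α β 1)
      (2 * Real.sin (2 * θ) * (polyRatio m α β 2 θ - polyRatio m α β 1 θ ^ 2)) θ := by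
  have h0 := ((seedPoly m α β).hasDerivAt (xvar θ)).comp θ (hasDerivAt_xvar θ)
  have h1 := ((Polynomial.derivative (seedPoly m α β)).hasDerivAt (xvar θ)).comp θ
    (hasDerivAt_xvar θ)
  have := h.2.2
  refine (h1.div h0 h.2.2).congr_deriv ?_
  simp only [polyRatio, Function.comp, Function.iterate_succ, Function.iterate_zero, id]
  field_simp

/-- The second derivative `d²/dθ² log |P(x)|`, where `P` is the seed polynomial. -/
def logPolyDeriv2 (m : ℕ) (α β θ : ℝ) : ℝ :=
  4 * Real.cos (2 * θ) * polyRatio m α β 1 θ +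
    4 * Real.sin (2 * θ) ^ 2 * (polyRatio m α β 2 θ - polyRatio m α β 1 θ ^ 2)

theorem hasDerivAt_logPolyDeriv {θ : ℝ} (h : θ ∈ angles m α β) :
    HasDerivAt (fun t => 2 * Real.sin (2 * t) * polyRatio m α β 1 t)
      (logPolyDeriv2 m α β θ) θ := by
  have hs : HasDerivAt (fun t : ℝ => 2 * Real.sin (2 * t)) (2 * (Real.cos (2 * θ) * (2 * 1))) θ :=
    (((hasDerivAt_id θ).const_mul 2).sin).const_mul 2
  refine (hs.mul (hasDerivAt_polyRatio h)).congr_deriv ?_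
  rw [logPolyDeriv2]
  ring

theorem deriv_log_abs_seedPoly {θ : ℝ} (h : θ ∈ angles m α β) :
    deriv (deriv fun t => Real.log |(seedPoly m α β).eval (xvar t)|) θ =
      logPolyDeriv2 m α β θ := by
  have he : (deriv fun t => Real.log |(seedPoly m α β).eval (xvar t)|) =ᶠ[nhds θ]
      fun t => 2 * Real.sin (2 * t) * polyRatio m α β 1 t := by
    filter_upwards [(isOpen_angles m α β).mem_nhds h] with t ht
    simp only [Real.log_abs]
    refine ((((seedPoly m α β).hasDerivAt (xvar t)).comp t (hasDerivAt_xvar t)).log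
      ht.2.2).deriv.trans ?_
    simp only [polyRatio, Function.comp, Function.iterate_one]
    ring
  rw [he.deriv_eq, (hasDerivAt_logPolyDeriv h).deriv]

theorem extPotential_eq {θ : ℝ} (h : θ ∈ angles m α β) :
    extPotential m α β θ = trigPotential α β θ - 2 * logPolyDeriv2 m α β θ := by
  rw [extPotential, deriv_log_abs_seedPoly h]

/-- The derivative of `w`. -/
def wDeriv (m : ℕ) (α β θ : ℝ) : ℝ :=
  -(β - 1 / 2) / Real.sin θ ^ 2 + (α + 1 / 2) / Real.cos θ ^ 2 + logPolyDeriv2 m α β θ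

theorem hasDerivAt_w {θ : ℝ} (h : θ ∈ angles m α β) :
    HasDerivAt (w m α β) (wDeriv m α β θ) θ := by
  have hs := (sin_pos_of_mem h).ne'
  have hc := (cos_pos_of_mem h).ne'
  have hsc := Real.sin_sq_add_cos_sq θ
  have he : w m α β =ᶠ[nhds θ] fun θ => (β - 1 / 2) * (Real.cos θ / Real.sin θ) +
      (α + 1 / 2) * (Real.sin θ / Real.cos θ) +
      2 * Real.sin (2 * θ) * polyRatio m α β 1 θ := by
    filter_upwards [(isOpen_angles m α β).mem_nhds h] with t ht using w_eq ht
  refine HasDerivAt.congr_of_eventuallyEq ?_ he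
  refine (((((Real.hasDerivAt_cos θ).div (Real.hasDerivAt_sin θ) hs).const_mul (β - 1 / 2)).add
    (((Real.hasDerivAt_sin θ).div (Real.hasDerivAt_cos θ) hc).const_mul (α + 1 / 2))).add
    (hasDerivAt_logPolyDeriv h)).congr_deriv ?_
  rw [wDeriv]
  have e1 : -Real.sin θ * Real.sin θ - Real.cos θ * Real.cos θ = -1 := by linear_combination -hsc
  have e2 : Real.cos θ * Real.cos θ - Real.sin θ * -Real.sin θ = 1 := by linear_combination hsc
  rw [e1, e2]
  ring

/-- Writing w = φ'/φ gives w' + w² = φ''/φ, so this is the equation -φ'' + Vφ = shift · φ for the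
seed, that is, the Jacobi equation after the gauge factor is removed. -/
theorem riccati {θ : ℝ} (h : θ ∈ angles m α β) :
    wDeriv m α β θ + w m α β θ ^ 2 + shift m α β = trigPotential (α + 1) (β - 1) θ := by
  have hs := (sin_pos_of_mem h).ne'
  have hc := (cos_pos_of_mem h).ne'
  have hsc := Real.sin_sq_add_cos_sq θ
  have hode : (1 - xvar θ ^ 2) * polyRatio m α β 2 θ +
      (α + β - (β - α) * xvar θ) * polyRatio m α β 1 θ + m * (m + β - α - 1) = 0 := by
    have h0 := jacobi_ode m (-α - 1) (β - 1) (xvar θ)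
    have h1 := h.2.2
    simp only [polyRatio, Function.iterate_succ, Function.comp, Function.iterate_zero, id]
    field_simp
    rw [seedPoly] at *
    linear_combination h0
  rw [w_eq h, wDeriv, logPolyDeriv2, shift, trigPotential]
  rw [xvar_eq] at hode
  rw [Real.sin_two_mul, Real.cos_two_mul']
  generalize polyRatio m α β 2 θ = v at *
  generalize polyRatio m α β 1 θ = u at *
  generalize Real.sin θ = s at *
  generalize Real.cos θ = c at *
  have h1 : (1 - (s ^ 2 - c ^ 2) ^ 2) = 4 * s ^ 2 * c ^ 2 := by
    linear_combination (-1 - s ^ 2 - c ^ 2) * hsc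
  have h2 : α + β - (β - α) * (s ^ 2 - c ^ 2) = 2 * α * s ^ 2 + 2 * β * c ^ 2 := by
    linear_combination (-α - β) * hsc
  rw [h1, h2] at hode
  -- Squared cotangent and tangent are traded for 1/s² - 1 and 1/c² - 1. Then the u² terms cancel
  -- and the rest is four times the Jacobi equation, with no further use of s² + c² = 1.
  have h3 : ((β - 1 / 2) * (c / s) + (α + 1 / 2) * (s / c) + 2 * (2 * s * c) * u) ^ 2 =
      (β - 1 / 2) ^ 2 * (1 / s ^ 2 - 1) + (α + 1 / 2) ^ 2 * (1 / c ^ 2 - 1) +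
      2 * (β - 1 / 2) * (α + 1 / 2) + 16 * s ^ 2 * c ^ 2 * u ^ 2 +
      8 * u * ((β - 1 / 2) * c ^ 2 + (α + 1 / 2) * s ^ 2) := by
    have e1 : 1 / s ^ 2 - 1 = (c / s) ^ 2 := by field_simp; linear_combination -hsc
    have e2 : 1 / c ^ 2 - 1 = (s / c) ^ 2 := by field_simp; linear_combination -hsc
    rw [e1, e2]
    field_simp
    ring
  rw [h3]
  linear_combination 4 * hode

/-- Changing the sign of w' in the Riccati equation subtracts 2w'. Its trigonometric part moves the
parameters (α + 1, β - 1) back to (α, β); the rest is -2 (log |P|)''. -/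
theorem extPotential_eq_sub {θ : ℝ} (h : θ ∈ angles m α β) :
    extPotential m α β θ = -wDeriv m α β θ + w m α β θ ^ 2 + shift m α β := by
  have h1 := riccati h
  rw [extPotential_eq h]
  unfold wDeriv at *
  unfold trigPotential at *
  linear_combination -h1

end

section


attribute [local instance] operatorRing

variable {m : ℕ} {α β : ℝ}

/-! ### Commutation relations of the elementary operators -/

/-- Together with `dθ_sin2θ`, this closes the span of x and sin 2θ under differentiation, which
keeps the algebra of the ladder operators finite. -/
theorem dθ_opX : dθ (dom m α β) * opX m α β =
    opX m α β * dθ (dom m α β) + (2 : ℂ) • sin2θ m α β :=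
  Operator.ext_on fun f p hp => by
    simp only [opX, sin2θ, Module.End.mul_apply, LinearMap.add_apply, LinearMap.smul_apply,
      Submodule.coe_add, Submodule.coe_smul, Pi.add_apply, Pi.smul_apply, mulOp_apply, smul_eq_mul]
    rw [dθ_mulOp_apply _ hp (hasDerivAt_xvar p.2)]
    push_cast
    ring

theorem dθ_sin2θ : dθ (dom m α β) * sin2θ m α β =
    sin2θ m α β * dθ (dom m α β) - (2 : ℂ) • opX m α β :=
  Operator.ext_on fun f p hp => by
    simp only [opX, sin2θ, Module.End.mul_apply, LinearMap.sub_apply, LinearMap.smul_apply,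
      Submodule.coe_sub, Submodule.coe_smul, Pi.sub_apply, Pi.smul_apply, mulOp_apply, smul_eq_mul]
    rw [dθ_mulOp_apply _ hp (((hasDerivAt_id p.2).const_mul 2).sin)]
    simp only [xvar, id]
    push_cast
    ring

theorem dr_rPow (n : ℤ) : dr (dom m α β) * rPow m α β n =
    rPow m α β n * dr (dom m α β) + (n : ℂ) • rPow m α β (n - 1) :=
  Operator.ext_on fun f p hp => by
    simp only [rPow, Module.End.mul_apply, LinearMap.add_apply, LinearMap.smul_apply,
      Submodule.coe_add, Submodule.coe_smul, Pi.add_apply, Pi.smul_apply, mulOp_apply, smul_eq_mul]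
    rw [dr_mulOp_apply _ hp (hasDerivAt_zpow n p.1 (Or.inl hp.1.ne'))]
    push_cast
    ring

theorem rPow_mul_rPow (k l : ℤ) : rPow m α β k * rPow m α β l = rPow m α β (k + l) :=
  Operator.ext_on fun f p hp => by
    simp only [rPow, Module.End.mul_apply, mulOp_apply]
    rw [zpow_add₀ hp.1.ne']
    push_cast
    ring

theorem rPow_zero : rPow m α β 0 = 1 :=
  Operator.ext_on fun f p hp => by
    simp [rPow, mulOp_apply]

theorem dθ_commute_rPow (n : ℤ) : Commute (dθ (dom m α β)) (rPow m α β n) :=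
  Operator.ext_on fun f p hp => by
    simp only [rPow, Module.End.mul_apply, mulOp_apply]
    rw [dθ_mulOp_apply _ hp (hasDerivAt_const p.2 (p.1 ^ n))]
    push_cast
    ring

/-- Operators that commute with `∂_r` and with the powers of `r`. -/
def IsAngular (X : Operator (dom m α β)) : Prop :=
  Commute (dr (dom m α β)) X ∧ ∀ n : ℤ, Commute (rPow m α β n) X

theorem IsAngular.add {X Y : Operator (dom m α β)} (hX : IsAngular X) (hY : IsAngular Y) :
    IsAngular (X + Y) :=
  ⟨hX.1.add_right hY.1, fun n => (hX.2 n).add_right (hY.2 n)⟩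

theorem IsAngular.sub {X Y : Operator (dom m α β)} (hX : IsAngular X) (hY : IsAngular Y) :
    IsAngular (X - Y) :=
  ⟨hX.1.sub_right hY.1, fun n => (hX.2 n).sub_right (hY.2 n)⟩

theorem IsAngular.neg {X : Operator (dom m α β)} (hX : IsAngular X) : IsAngular (-X) :=
  ⟨hX.1.neg_right, fun n => (hX.2 n).neg_right⟩

theorem IsAngular.mul {X Y : Operator (dom m α β)} (hX : IsAngular X) (hY : IsAngular Y) :
    IsAngular (X * Y) :=
  ⟨hX.1.mul_right hY.1, fun n => (hX.2 n).mul_right (hY.2 n)⟩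

theorem IsAngular.smul_one (c : ℂ) : IsAngular (c • (1 : Operator (dom m α β))) :=
  ⟨(Commute.one_right _).smul_right c, fun _ => (Commute.one_right _).smul_right c⟩

theorem IsAngular.dθ : IsAngular (dθ (dom m α β)) :=
  ⟨dr_dθ_commute, fun n => (dθ_commute_rPow n).symm⟩

theorem IsAngular.mulOp {g : ℝ → ℝ}
    (hg : ContDiffOn ℝ ∞ (fun p : ℝ × ℝ => g p.2) (dom m α β : Set (ℝ × ℝ))) :
    IsAngular (mulOp (dom m α β) (fun p => g p.2) hg) :=
  ⟨Operator.ext_on fun f p hp => by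
    simp only [Module.End.mul_apply, mulOp_apply]
    rw [dr_mulOp_apply _ hp (hasDerivAt_const p.1 (g p.2))]
    push_cast
    ring, fun n => mulOp_mul_mulOp _ _⟩

theorem IsAngular.opw : IsAngular (opw m α β) := .mulOp (g := w m α β) _

theorem IsAngular.opX : IsAngular (opX m α β) := .mulOp (g := xvar) _

theorem IsAngular.A : IsAngular (A m α β) := IsAngular.dθ.sub .opw

theorem IsAngular.Adag : IsAngular (Adag m α β) := IsAngular.dθ.neg.sub .opw

theorem IsAngular.opS : IsAngular (opS m α β) :=
  (IsAngular.mulOp (g := fun θ => Real.sin (2 * θ)) _).mul .dθ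

theorem IsAngular.L2 : IsAngular (L2 m α β) := (IsAngular.A.mul .Adag).add (.smul_one _)

/-! ### The factorization -/

/-- Expanding gives A†A = -∂² + w' + w², to which the Riccati equation applies. -/
theorem Adag_mul_A_apply (f : Smooth (dom m α β)) {p : ℝ × ℝ} (hp : p ∈ dom m α β) :
    ((Adag m α β * A m α β + (shift m α β : ℂ) • 1) f : ℝ × ℝ → ℂ) p =
      -((dθ (dom m α β) ^ 2) f : ℝ × ℝ → ℂ) p +
        (trigPotential (α + 1) (β - 1) p.2 : ℂ) * (f : ℝ × ℝ → ℂ) p := by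
  have h1 := dθ_mulOp_apply (contDiffOn_w m α β) hp (hasDerivAt_w hp.2) f
  have h2 := congrArg (fun x : ℝ => (x : ℂ)) (riccati hp.2)
  simp only [Adag, A, opw, pow_two, Module.End.mul_apply, LinearMap.add_apply, LinearMap.sub_apply,
    LinearMap.smul_apply, LinearMap.neg_apply, map_sub, Submodule.coe_add, Submodule.coe_sub,
    Submodule.coe_neg, Submodule.coe_smul, Pi.add_apply, Pi.sub_apply, Pi.neg_apply, Pi.smul_apply,
    mulOp_apply, smul_eq_mul, Module.End.one_apply, h1]
  push_cast at h2
  rw [← h2]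
  ring

theorem L2_apply (f : Smooth (dom m α β)) {p : ℝ × ℝ} (hp : p ∈ dom m α β) :
    (L2 m α β f : ℝ × ℝ → ℂ) p =
      -((dθ (dom m α β) ^ 2) f : ℝ × ℝ → ℂ) p +
        (extPotential m α β p.2 : ℂ) * (f : ℝ × ℝ → ℂ) p := by
  have h1 := dθ_mulOp_apply (contDiffOn_w m α β) hp (hasDerivAt_w hp.2) f
  simp only [L2, Adag, A, opw, pow_two, Module.End.mul_apply, LinearMap.add_apply,
    LinearMap.sub_apply,
    LinearMap.smul_apply, LinearMap.neg_apply, map_sub, map_neg, Submodule.coe_add,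
    Submodule.coe_sub,
    Submodule.coe_neg, Submodule.coe_smul, Pi.add_apply, Pi.sub_apply, Pi.neg_apply, Pi.smul_apply,
    mulOp_apply, smul_eq_mul, Module.End.one_apply, h1, extPotential_eq_sub hp.2]
  push_cast
  ring

/-- The partner `A† A + (2m - α + β - 1)²` of `L₂`. -/
def partner (m : ℕ) (α β : ℝ) : Operator (dom m α β) :=
  Adag m α β * A m α β + (shift m α β : ℂ) • 1

/-- The intertwining relation is associativity of AA†A, since both operators carry the same additive
constant. -/
theorem L2_mul_A : L2 m α β * A m α β = A m α β * partner m α β := by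
  simp only [L2, partner, add_mul, mul_add, mul_assoc, smul_mul_assoc, mul_smul_comm, one_mul,
    mul_one]

theorem partner_mul_Adag : partner m α β * Adag m α β = Adag m α β * L2 m α β := by
  simp only [L2, partner, add_mul, mul_add, mul_assoc, smul_mul_assoc, mul_smul_comm, one_mul,
    mul_one]

theorem contDiffOn_trigPotential (m : ℕ) (α β a b : ℝ) :
    ContDiffOn ℝ ∞ (fun p : ℝ × ℝ => trigPotential a b p.2) (dom m α β : Set (ℝ × ℝ)) := by
  unfold trigPotential
  refine (contDiffOn_const.div (by fun_prop) fun p hp => ?_).add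
    (contDiffOn_const.div (by fun_prop) fun p hp => ?_)
  · exact pow_ne_zero 2 (cos_pos_of_mem hp.2).ne'
  · exact pow_ne_zero 2 (sin_pos_of_mem hp.2).ne'

/-- Multiplication by the potential of the partner of `L₂`. -/
def opV (m : ℕ) (α β : ℝ) : Operator (dom m α β) :=
  mulOp (dom m α β) (fun p => trigPotential (α + 1) (β - 1) p.2)
    (contDiffOn_trigPotential m α β (α + 1) (β - 1))

theorem partner_eq : partner m α β = opV m α β - dθ (dom m α β) * dθ (dom m α β) :=
  Operator.ext_on fun f p hp => by
    rw [partner, Adag_mul_A_apply f hp, opV, pow_two]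
    simp only [LinearMap.sub_apply, Submodule.coe_sub, Pi.sub_apply, mulOp_apply]
    ring

theorem opX_mul_opV : opX m α β * opV m α β = opV m α β * opX m α β := mulOp_mul_mulOp _ _

/-- For V = a/cos² + b/sin² one has sin 2θ · V' = 4xV + 4(a - b), and here a - b = (α + 1)² - (β -
1)² = δ. This is the source of δ. -/
theorem opS_mul_opV : opS m α β * opV m α β =
    opV m α β * opS m α β + (4 : ℂ) • (opX m α β * opV m α β) + (4 * delta α β : ℂ) • 1 :=
  Operator.ext_on fun f p hp => by
    have hs := (sin_pos_of_mem hp.2).ne'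
    have hc := (cos_pos_of_mem hp.2).ne'
    have hsc := Real.sin_sq_add_cos_sq p.2
    have hV : HasDerivAt (trigPotential (α + 1) (β - 1))
        (2 * ((α + 1) ^ 2 - 1 / 4) * Real.sin p.2 / Real.cos p.2 ^ 3 -
          2 * ((β - 1) ^ 2 - 1 / 4) * Real.cos p.2 / Real.sin p.2 ^ 3) p.2 := by
      refine (((hasDerivAt_const p.2 ((α + 1) ^ 2 - 1 / 4)).div
        ((Real.hasDerivAt_cos p.2).pow 2) (pow_ne_zero 2 hc)).add
        ((hasDerivAt_const p.2 ((β - 1) ^ 2 - 1 / 4)).div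
        ((Real.hasDerivAt_sin p.2).pow 2) (pow_ne_zero 2 hs))).congr_deriv ?_
      simp only [Pi.pow_apply]
      field_simp
      ring
    have h1 := dθ_mulOp_apply (contDiffOn_trigPotential m α β (α + 1) (β - 1)) hp hV f
    have key : Real.sin (2 * p.2) * (2 * ((α + 1) ^ 2 - 1 / 4) * Real.sin p.2 / Real.cos p.2 ^ 3 -
          2 * ((β - 1) ^ 2 - 1 / 4) * Real.cos p.2 / Real.sin p.2 ^ 3) =
        4 * (xvar p.2 * trigPotential (α + 1) (β - 1) p.2) + 4 * delta α β := by
      rw [xvar_eq, Real.sin_two_mul, trigPotential, delta]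
      generalize Real.sin p.2 = s at *
      generalize Real.cos p.2 = c at *
      field_simp
      ring
    simp only [opS, opV, opX, sin2θ, Module.End.mul_apply, LinearMap.add_apply,
      LinearMap.smul_apply, Submodule.coe_add, Submodule.coe_smul, Pi.add_apply, Pi.smul_apply,
      mulOp_apply, smul_eq_mul, Module.End.one_apply, h1]
    have key' := congrArg (fun x : ℝ => (x : ℂ)) key
    push_cast at key' ⊢
    linear_combination (f : ℝ × ℝ → ℂ) p * key'

theorem partner_mul_opX : partner m α β * opX m α β =
    opX m α β * partner m α β + (4 : ℂ) • opX m α β - (4 : ℂ) • opS m α β := by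
  have h : dθ (dom m α β) * dθ (dom m α β) * opX m α β =
      opX m α β * (dθ (dom m α β) * dθ (dom m α β)) + (4 : ℂ) • opS m α β -
        (4 : ℂ) • opX m α β := by
    rw [mul_assoc, dθ_opX, mul_add, ← mul_assoc, dθ_opX, mul_smul_comm, dθ_sin2θ, opS, add_mul,
      smul_mul_assoc, mul_assoc]
    module
  rw [partner_eq, sub_mul, h, mul_sub, opX_mul_opV]
  abel

/-- The kinetic term contributes 4x∂² and the potential -4xV - 4δ; these recombine into -4x times
the partner, so no new operator appears. -/
theorem partner_mul_opS : partner m α β * opS m α β =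
    opS m α β * partner m α β + (4 : ℂ) • opS m α β - (4 : ℂ) • (opX m α β * partner m α β) -
      (4 * delta α β : ℂ) • 1 := by
  have h : dθ (dom m α β) * dθ (dom m α β) * opS m α β =
      opS m α β * (dθ (dom m α β) * dθ (dom m α β)) -
        (4 : ℂ) • (opX m α β * (dθ (dom m α β) * dθ (dom m α β))) - (4 : ℂ) • opS m α β := by
    have h1 : dθ (dom m α β) * opS m α β = opS m α β * dθ (dom m α β) -
        (2 : ℂ) • (opX m α β * dθ (dom m α β)) := by
      rw [opS, ← mul_assoc, dθ_sin2θ, sub_mul, smul_mul_assoc]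
    rw [mul_assoc, h1, mul_sub, mul_smul_comm, ← mul_assoc, h1, ← mul_assoc (dθ (dom m α β)),
      dθ_opX, sub_mul, add_mul, smul_mul_assoc, smul_mul_assoc, mul_assoc, mul_assoc, ← opS]
    module
  rw [partner_eq, sub_mul, h, mul_sub, opS_mul_opV, mul_sub]
  module

/-! ### Commutators of `L₂` with the conjugated ladder operators -/

/-- Pushing `L2` through `A` from the left turns it into the partner, and pushing the partner
through `Adag` turns it back. Commutators are thus transported from the trigonometric operator to
its extension. -/
theorem conj_relation {X Y : Operator (dom m α β)}
    (h : partner m α β * X = X * partner m α β + Y) :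
    L2 m α β * (A m α β * X * Adag m α β) =
      A m α β * X * Adag m α β * L2 m α β + A m α β * Y * Adag m α β := by
  calc L2 m α β * (A m α β * X * Adag m α β)
      = L2 m α β * A m α β * X * Adag m α β := by simp only [mul_assoc]
    _ = A m α β * (partner m α β * X) * Adag m α β := by rw [L2_mul_A]; simp only [mul_assoc]
    _ = A m α β * X * (partner m α β * Adag m α β) + A m α β * Y * Adag m α β := by
        rw [h, mul_add, add_mul]; simp only [mul_assoc]
    _ = _ := by rw [partner_mul_Adag]; simp only [mul_assoc]

theorem L2_mul_conj_opX : L2 m α β * (A m α β * opX m α β * Adag m α β) =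
    A m α β * opX m α β * Adag m α β * L2 m α β +
      (4 : ℂ) • (A m α β * opX m α β * Adag m α β) -
      (4 : ℂ) • (A m α β * opS m α β * Adag m α β) := by
  rw [conj_relation (partner_mul_opX.trans (add_sub_assoc _ _ _)), mul_sub, sub_mul]
  simp only [mul_smul_comm, smul_mul_assoc]
  abel

theorem L2_mul_conj_opS : L2 m α β * (A m α β * opS m α β * Adag m α β) =
    A m α β * opS m α β * Adag m α β * L2 m α β +
      (4 : ℂ) • (A m α β * opS m α β * Adag m α β) -
      (4 : ℂ) • (A m α β * opX m α β * Adag m α β * L2 m α β) -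
      (4 * delta α β : ℂ) • (A m α β * Adag m α β) := by
  rw [conj_relation (X := opS m α β) (Y := (4 : ℂ) • opS m α β -
    (4 : ℂ) • (opX m α β * partner m α β) - (4 * delta α β : ℂ) • 1)
    (by rw [partner_mul_opS]; abel)]
  have h : A m α β * (opX m α β * partner m α β) * Adag m α β =
      A m α β * opX m α β * Adag m α β * L2 m α β := by
    simp only [mul_assoc, partner_mul_Adag]
  simp only [mul_sub, sub_mul, mul_smul_comm, smul_mul_assoc, mul_one, h]
  abel

/-! ### The radial operators -/

theorem dr_rPow_mul (n : ℤ) (X : Operator (dom m α β)) : dr (dom m α β) * (rPow m α β n * X) =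
    rPow m α β n * (dr (dom m α β) * X) + (n : ℂ) • (rPow m α β (n - 1) * X) := by
  rw [← mul_assoc, dr_rPow, add_mul, mul_assoc, smul_mul_assoc]

theorem rPow_mul_rPow_mul (k l : ℤ) (X : Operator (dom m α β)) :
    rPow m α β k * (rPow m α β l * X) = rPow m α β (k + l) * X := by
  rw [← mul_assoc, rPow_mul_rPow]

/-- The operator `(1/r) ∂_r`. -/
def opE (m : ℕ) (α β : ℝ) : Operator (dom m α β) := rPow m α β (-1) * dr (dom m α β)

/-- The operator `(1/r) ∂_r r ∂_r`. -/
def opK (m : ℕ) (α β : ℝ) : Operator (dom m α β) :=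
  rPow m α β (-1) * dr (dom m α β) * rPow m α β 1 * dr (dom m α β)

theorem opE_mul_rPow (n : ℤ) : opE m α β * rPow m α β n =
    rPow m α β n * opE m α β + (n : ℂ) • rPow m α β (n - 2) := by
  simp only [opE, mul_assoc, dr_rPow, mul_add, mul_smul_comm, rPow_mul_rPow, rPow_mul_rPow_mul]
  ring_nf

/-- Expressing the radial Laplacian through E = (1/r)∂_r reduces every radial commutator to [E, r^n]
= n r^{n-2}. -/
theorem opK_eq : opK m α β = rPow m α β 2 * (opE m α β * opE m α β) +
    (2 : ℂ) • opE m α β := by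
  simp only [opE, opK, mul_assoc, dr_rPow_mul, mul_add, mul_smul_comm, rPow_mul_rPow_mul]
  norm_num [rPow_zero]
  module

theorem opK_mul_rPow (n : ℤ) : opK m α β * rPow m α β n =
    rPow m α β n * opK m α β + (2 * n : ℂ) • (rPow m α β n * opE m α β) +
      (n ^ 2 : ℂ) • rPow m α β (n - 2) := by
  rw [opK_eq]
  simp only [mul_assoc, add_mul, mul_add, opE_mul_rPow, mul_smul_comm, smul_mul_assoc,
    rPow_mul_rPow_mul]
  rw [← mul_assoc (opE m α β), opE_mul_rPow]
  simp only [mul_assoc, mul_add, add_mul, mul_smul_comm, smul_mul_assoc,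
    rPow_mul_rPow_mul, rPow_mul_rPow, smul_add]
  push_cast
  ring_nf
  module

theorem opK_mul_opE : opK m α β * opE m α β = opE m α β * opK m α β -
    (2 : ℂ) • (rPow m α β (-2) * opK m α β) + (4 : ℂ) • (rPow m α β (-2) * opE m α β) := by
  have h : opE m α β * rPow m α β 2 = rPow m α β 2 * opE m α β + (2 : ℂ) • 1 := by
    simpa [rPow_zero] using opE_mul_rPow (m := m) (α := α) (β := β) 2
  rw [opK_eq]
  simp only [mul_add, add_mul, mul_smul_comm, smul_mul_assoc, ← mul_assoc, h, rPow_mul_rPow]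
  norm_num [rPow_zero]
  module

end

section


/-! ### The commutation relation of `H` and `L₄` -/

section Abstract

variable {R : Type*} [Ring R]

/-- In right-associated products a relation ab = c must be applied at the head of a longer word. -/
theorem mul_mul_eq_of_mul_eq {a b c : R} (h : a * b = c) (x : R) : a * (b * x) = c * x := by
  rw [← mul_assoc, h]

/-- The dictionary is q = r⁻², z = r², e = (1/r)∂_r, K = (1/r)∂_r r∂_r, T = L₂, G₃ = ASA†, G₂ =
AxA†, c = ω², and T - σ = AA†. The two commuting elements are 2H and 2L₄. -/
theorem commute_of_ladder_relations [Algebra ℂ R] {q e z K T G₃ G₂ : R} (c δ σ : ℂ)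
    (hqT : q * T = T * q) (heT : e * T = T * e) (hzT : z * T = T * z) (hKT : K * T = T * K)
    (hqG₃ : q * G₃ = G₃ * q) (hzG₃ : z * G₃ = G₃ * z) (hKG₃ : K * G₃ = G₃ * K)
    (hqG₂ : q * G₂ = G₂ * q) (hzG₂ : z * G₂ = G₂ * z) (hKG₂ : K * G₂ = G₂ * K)
    (hTG₃ : T * G₃ = G₃ * T + (4 : ℂ) • G₃ - (4 : ℂ) • (G₂ * T) - (4 * δ) • (T - σ • 1))
    (hTG₂ : T * G₂ = G₂ * T + (4 : ℂ) • G₂ - (4 : ℂ) • G₃)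
    (hzq : z * q = 1) (hqz : q * z = 1) (heq : e * q = q * e - (2 : ℂ) • (q * q))
    (hKq : K * q = q * K - (4 : ℂ) • (q * e) + (4 : ℂ) • (q * q))
    (hez : e * z = z * e + (2 : ℂ) • 1)
    (hKz : K * z = z * K + (4 : ℂ) • (z * e) + (4 : ℂ) • 1)
    (hKe : K * e = e * K - (2 : ℂ) • (q * K) + (4 : ℂ) • (q * e)) :
    Commute (-K + c • z + q * T)
      (G₃ * (q - e) + G₂ * (e - q * T + (1 / 2 : ℂ) • (-K + c • z + q * T)) -
        δ • (q * (T - σ • 1))) := by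
  rw [commute_iff_eq]
  -- The relations are oriented to move G₃ and G₂ to the left, then T, then powers of r, then e,
  -- then K. Both products reach this normal form, and only a comparison of coefficients is left.
  simp only [mul_add, add_mul, mul_sub, sub_mul, mul_smul_comm, smul_mul_assoc, mul_assoc,
    mul_one, one_mul, neg_mul, mul_neg, smul_add, smul_sub, smul_neg, smul_smul,
    hzq, hqz, heq, hKq, hez, hKz, hKe,
    mul_mul_eq_of_mul_eq hqT, mul_mul_eq_of_mul_eq heT, mul_mul_eq_of_mul_eq hzT,
    mul_mul_eq_of_mul_eq hKT, mul_mul_eq_of_mul_eq hqG₃,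
    mul_mul_eq_of_mul_eq hzG₃, mul_mul_eq_of_mul_eq hKG₃, mul_mul_eq_of_mul_eq hqG₂,
    mul_mul_eq_of_mul_eq hzG₂, mul_mul_eq_of_mul_eq hKG₂,
    mul_mul_eq_of_mul_eq hTG₃, mul_mul_eq_of_mul_eq hTG₂, hTG₂, hqT]
  module

end Abstract

attribute [local instance] operatorRing

variable {m : ℕ} {α β : ℝ}

theorem IsAngular.commute_opE {X : Operator (dom m α β)} (hX : IsAngular X) :
    opE m α β * X = X * opE m α β :=
  ((hX.2 (-1)).mul_left hX.1).eq

theorem IsAngular.commute_opK {X : Operator (dom m α β)} (hX : IsAngular X) :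
    opK m α β * X = X * opK m α β :=
  ((((hX.2 (-1)).mul_left hX.1).mul_left (hX.2 1)).mul_left hX.1).eq

theorem H_eq (freq : ℝ) : H m α β freq =
    (1 / 2 : ℂ) • (-opK m α β + (freq ^ 2 : ℂ) • rPow m α β 2 + rPow m α β (-2) * L2 m α β) := by
  rw [H, opK]
  module

theorem A_mul_Adag : A m α β * Adag m α β = L2 m α β - (shift m α β : ℂ) • 1 := by
  rw [L2, add_sub_cancel_right]

theorem H_commute_L2 (freq : ℝ) : Commute (H m α β freq) (L2 m α β) := by
  have hL := IsAngular.L2 (m := m) (α := α) (β := β)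
  rw [H_eq]
  refine Commute.smul_left (((Commute.neg_left hL.commute_opK).add_left
    ((hL.2 2).smul_left _)).add_left ((hL.2 (-2)).mul_left (Commute.refl _))) _

theorem H_commute_L4 (freq : ℝ) : Commute (H m α β freq) (L4 m α β freq) := by
  have hT := IsAngular.L2 (m := m) (α := α) (β := β)
  have h3 := (IsAngular.A.mul IsAngular.opS).mul (IsAngular.Adag (m := m) (α := α) (β := β))
  have h2 := (IsAngular.A.mul IsAngular.opX).mul (IsAngular.Adag (m := m) (α := α) (β := β))
  have key := commute_of_ladder_relations (freq ^ 2 : ℂ) (delta α β : ℂ) (shift m α β : ℂ)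
    (hT.2 (-2)) hT.commute_opE (hT.2 2) hT.commute_opK
    (h3.2 (-2)) (h3.2 2) h3.commute_opK
    (h2.2 (-2)) (h2.2 2) h2.commute_opK
    (by rw [L2_mul_conj_opS, A_mul_Adag]) L2_mul_conj_opX
    (by rw [rPow_mul_rPow]; exact rPow_zero) (by rw [rPow_mul_rPow]; exact rPow_zero)
    (by rw [opE_mul_rPow, rPow_mul_rPow]; norm_num; module)
    (by rw [opK_mul_rPow, rPow_mul_rPow]; norm_num; module)
    (by rw [opE_mul_rPow]; norm_num [rPow_zero])
    (by rw [opK_mul_rPow]; norm_num [rPow_zero])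
    opK_mul_opE
  rw [L4, ← opE, A_mul_Adag]
  -- `H` occurs twice, as the outer operator and inside `L4`; both are expanded, and each overall
  -- factor 1/2 is harmless for commutation.
  nth_rewrite 1 [H_eq]
  rw [H_eq]
  exact (key.smul_left _).smul_right _

/-! ### The integral `L₄` in terms of ladder operators -/

/-- On a joint eigenfunction, `L2` and `H` inside `L4` become numbers, and both sides are
combinations of ASA†, AxA†, AA† applied to radial terms. The two ladder products are exchanged by Λ
↦ -Λ; together they leave -δE/(2(1 - Λ²)) AA†, which the last term cancels. -/
theorem L4_apply_of_eigen {freq : ℝ} {Φ : Smooth (dom m α β)} {Λ E : ℂ} (h0 : Λ ≠ 0)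
    (h1 : Λ ≠ 1) (h1' : Λ ≠ -1) (hL : L2 m α β Φ = Λ ^ 2 • Φ) (hH : H m α β freq Φ = E • Φ) :
    L4 m α β freq Φ =
      (1 / (4 * Λ * (1 - Λ))) • (BLadder m α β Λ * CLadder m α β (-Λ) E) Φ
        - (1 / (4 * Λ * (1 + Λ))) • (BLadder m α β (-Λ) * CLadder m α β Λ E) Φ
        + ((delta α β : ℂ) * E / (2 * (1 - Λ ^ 2))) • (A m α β * Adag m α β) Φ := by
  have hd1 : 1 - Λ ≠ 0 := sub_ne_zero.2 h1.symm
  have hd2 : 1 + Λ ≠ 0 := fun h => h1' (by linear_combination h)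
  have hd3 : 1 - Λ ^ 2 ≠ 0 := by
    rw [show 1 - Λ ^ 2 = (1 - Λ) * (1 + Λ) by ring]
    exact mul_ne_zero hd1 hd2
  have hB : ∀ M : ℂ, BLadder m α β M = (1 - M) • (A m α β * opS m α β * Adag m α β) +
      (M * (1 - M)) • (A m α β * opX m α β * Adag m α β) -
      (delta α β : ℂ) • (A m α β * Adag m α β) := by
    intro M
    simp only [BLadder, bLadder, mul_add, mul_sub, add_mul, sub_mul, mul_smul_comm, smul_mul_assoc,
      mul_one]
  -- The factor r⁻² moves to the right of AA†, so that all angular operators stand on the left.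
  have h00 := ((IsAngular.A.mul (IsAngular.Adag (m := m) (α := α) (β := β))).2 (-2)).eq
  rw [L4, h00, hB, hB, CLadder, CLadder]
  generalize A m α β * opS m α β * Adag m α β = G₃
  generalize A m α β * opX m α β * Adag m α β = G₂
  generalize A m α β * Adag m α β = G₀
  simp only [Module.End.mul_apply, LinearMap.add_apply, LinearMap.sub_apply, LinearMap.smul_apply,
    map_add, map_sub, map_smul, hL, hH, Module.End.one_apply, smul_add, smul_sub, smul_smul]
  match_scalars <;> field_simp <;> ring

end

section


attribute [local instance] operatorRing

variable {U : TopologicalSpace.Opens (ℝ × ℝ)}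

/-! ### Principal symbols -/

/-- The exponential `exp (t (a r + b θ))` as an element of `C^∞(U)`. -/
def phase (U : TopologicalSpace.Opens (ℝ × ℝ)) (a b t : ℂ) : Smooth U :=
  ofFun (fun p => Complex.exp (t * (a * p.1 + b * p.2)))
    ((contDiff_const.mul ((contDiff_const.mul (Complex.ofRealCLM.contDiff.comp contDiff_fst)).add
      (contDiff_const.mul (Complex.ofRealCLM.contDiff.comp contDiff_snd)))).cexp.contDiffOn)

theorem phase_apply (a b t : ℂ) {p : ℝ × ℝ} (hp : p ∈ U) :
    (phase U a b t : ℝ × ℝ → ℂ) p = Complex.exp (t * (a * p.1 + b * p.2)) :=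
  ofFun_apply _ hp

theorem mulC_phase_mul_neg (a b t : ℂ) : mulC (phase U a b t) * mulC (phase U a b (-t)) = 1 :=
  Operator.ext_on fun f p hp => by
    simp only [Module.End.mul_apply, mulC_apply, phase_apply _ _ _ hp, Module.End.one_apply]
    rw [← mul_assoc, ← Complex.exp_add]
    simp

theorem dirDeriv_phase (v : ℝ × ℝ) (a b t : ℂ) :
    dirDeriv U v (phase U a b t) = (t * (a * v.1 + b * v.2)) • phase U a b t :=
  Smooth.ext_on fun p hp => by
    rw [dirDeriv_apply _ _ hp]
    simp only [Submodule.coe_smul, Pi.smul_apply, smul_eq_mul, phase_apply _ _ _ hp]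
    have he : (phase U a b t : ℝ × ℝ → ℂ) =ᶠ[nhds p]
        fun q => Complex.exp (t * (a * q.1 + b * q.2)) := by
      filter_upwards [U.isOpen.mem_nhds hp] with q hq using phase_apply a b t hq
    have h1 : HasFDerivAt (fun q : ℝ × ℝ => (q.1 : ℂ))
        (Complex.ofRealCLM.comp (ContinuousLinearMap.fst ℝ ℝ ℝ)) p :=
      (Complex.ofRealCLM.comp (ContinuousLinearMap.fst ℝ ℝ ℝ)).hasFDerivAt
    have h2 : HasFDerivAt (fun q : ℝ × ℝ => (q.2 : ℂ))
        (Complex.ofRealCLM.comp (ContinuousLinearMap.snd ℝ ℝ ℝ)) p :=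
      (Complex.ofRealCLM.comp (ContinuousLinearMap.snd ℝ ℝ ℝ)).hasFDerivAt
    have h := (((h1.const_mul a).add (h2.const_mul b)).const_mul t).cexp
    rw [he.fderiv_eq]
    refine (congrArg (fun L : ℝ × ℝ →L[ℝ] ℂ => L v) h.fderiv).trans ?_
    simp
    ring

/-- Conjugation by `exp (t (a r + b θ))`. -/
def conj (a b t : ℂ) (X : Operator U) : Operator U :=
  mulC (phase U a b (-t)) * X * mulC (phase U a b t)

theorem conj_mul (a b t : ℂ) (X Y : Operator U) :
    conj a b t (X * Y) = conj a b t X * conj a b t Y := by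
  have h := mulC_phase_mul_neg (U := U) a b t
  calc conj a b t (X * Y) = mulC (phase U a b (-t)) * X * 1 * (Y * mulC (phase U a b t)) := by
        simp only [conj, mul_assoc, one_mul]
    _ = _ := by rw [← h]; simp only [conj, mul_assoc]

theorem conj_add (a b t : ℂ) (X Y : Operator U) :
    conj a b t (X + Y) = conj a b t X + conj a b t Y := by
  simp only [conj, mul_add, add_mul]

theorem conj_mulC (a b t : ℂ) (g : Smooth U) : conj a b t (mulC g) = mulC g := by
  rw [conj, mulC_mul_comm _ g, mul_assoc, mulC_mul_comm (phase U a b (-t)), mulC_phase_mul_neg,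
    mul_one]

theorem conj_dirDeriv (v : ℝ × ℝ) (a b t : ℂ) :
    conj a b t (dirDeriv U v) = dirDeriv U v + (t * (a * v.1 + b * v.2)) • 1 := by
  have h := mulC_phase_mul_neg (U := U) a b t
  rw [mulC_mul_comm] at h
  rw [conj, mul_assoc, dirDeriv_mul_mulC, dirDeriv_phase, map_smul, mul_add, ← mul_assoc, h,
    mul_smul_comm, h, one_mul]

open Polynomial in
/-- The operator `X` has order at most `k`, and its homogeneous symbol of degree `k`, evaluated at
the covector `(a, b)`, is the function `s`: conjugating `X` by `exp (t (a r + b θ))` gives a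
polynomial in `t` of degree at most `k` with leading coefficient `s`. -/
def HasSymbol (a b : ℂ) (k : ℕ) (X : Operator U) (s : ℝ × ℝ → ℂ) : Prop :=
  ∃ Q : (Operator U)[X], Q.natDegree ≤ k ∧
    (∀ (f : Smooth U), ∀ p ∈ U, (Q.coeff k f : ℝ × ℝ → ℂ) p = s p * (f : ℝ × ℝ → ℂ) p) ∧
    ∀ t : ℂ, conj a b t X = Q.eval (t • 1)

variable {a b : ℂ} {k l : ℕ} {X Y : Operator U} {s s' : ℝ × ℝ → ℂ}

theorem HasSymbol.congr (h : HasSymbol a b k X s) (hs : ∀ p ∈ U, s p = s' p) :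
    HasSymbol a b k X s' := by
  obtain ⟨Q, h1, h2, h3⟩ := h
  exact ⟨Q, h1, fun f p hp => by rw [h2 f p hp, hs p hp], h3⟩

/-- Conjugation is multiplicative, and so is taking the coefficient of top degree. -/
theorem HasSymbol.mul (hX : HasSymbol a b k X s) (hY : HasSymbol a b l Y s') :
    HasSymbol a b (k + l) (X * Y) (s * s') := by
  obtain ⟨P, h1, h2, h3⟩ := hX
  obtain ⟨Q, g1, g2, g3⟩ := hY
  refine ⟨P * Q, Polynomial.natDegree_mul_le.trans (add_le_add h1 g1), fun f p hp => ?_,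
    fun t => ?_⟩
  · rw [Polynomial.coeff_mul_add_eq_of_natDegree_le h1 g1, Module.End.mul_apply, h2 _ p hp,
      g2 f p hp, Pi.mul_apply, mul_assoc]
  · rw [conj_mul, h3, g3]
    -- The coefficients do not commute with each other, but the point t · 1 is central, so
    -- evaluation there is multiplicative.
    refine (Polynomial.eval₂_mul_noncomm (RingHom.id _) _ fun i => ?_).symm
    exact (Commute.one_right _).smul_right t

theorem HasSymbol.add (hX : HasSymbol a b k X s) (hY : HasSymbol a b k Y s') :
    HasSymbol a b k (X + Y) (s + s') := by
  obtain ⟨P, h1, h2, h3⟩ := hX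
  obtain ⟨Q, g1, g2, g3⟩ := hY
  refine ⟨P + Q, Polynomial.natDegree_add_le_of_degree_le h1 g1, fun f p hp => ?_, fun t => ?_⟩
  · rw [Polynomial.coeff_add, LinearMap.add_apply, Submodule.coe_add, Pi.add_apply, h2 f p hp,
      g2 f p hp, Pi.add_apply, add_mul]
  · rw [conj_add, h3, g3, Polynomial.eval_add]

/-- This is how lower-order terms are discarded in symbol computations. -/
theorem HasSymbol.of_lt (hX : HasSymbol a b k X s) (h : k < l) : HasSymbol a b l X 0 := by
  obtain ⟨P, h1, -, h3⟩ := hX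
  refine ⟨P, h1.trans h.le, fun f p _ => ?_, h3⟩
  rw [Polynomial.coeff_eq_zero_of_natDegree_lt (h1.trans_lt h)]
  simp

theorem HasSymbol.add_of_lt (hX : HasSymbol a b k X s) (hY : HasSymbol a b l Y s') (h : l < k) :
    HasSymbol a b k (X + Y) s := by
  simpa using hX.add (hY.of_lt h)

theorem hasSymbol_mulC (g : Smooth U) : HasSymbol a b 0 (mulC g) g :=
  ⟨Polynomial.C (mulC g), by simp, fun f p _ => by simp [mulC_apply], fun t => by
    simp [conj_mulC]⟩

theorem hasSymbol_mulOp {g : ℝ × ℝ → ℝ} (hg : ContDiffOn ℝ ∞ g (U : Set (ℝ × ℝ))) :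
    HasSymbol a b 0 (mulOp U g hg) fun p => (g p : ℂ) := by
  rw [mulOp_eq_mulC]
  exact (hasSymbol_mulC _).congr fun p hp => ofFun_apply _ hp

theorem hasSymbol_one : HasSymbol a b 0 (1 : Operator U) 1 := by
  rw [← mulC_one]
  exact (hasSymbol_mulC _).congr fun p hp => ofFun_apply _ hp

theorem hasSymbol_smul_one (c : ℂ) : HasSymbol a b 0 (c • (1 : Operator U)) fun _ => c := by
  rw [← mulC_one, ← map_smul]
  refine (hasSymbol_mulC _).congr fun p hp => ?_
  simp [ofFun_apply _ hp]

theorem HasSymbol.smul (c : ℂ) (hX : HasSymbol a b k X s) : HasSymbol a b k (c • X) (c • s) := by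
  have h := (hasSymbol_smul_one (U := U) (a := a) (b := b) c).mul hX
  rw [zero_add, smul_one_mul] at h
  exact h

theorem HasSymbol.neg (hX : HasSymbol a b k X s) : HasSymbol a b k (-X) (-s) := by
  simpa using hX.smul (-1)

theorem HasSymbol.sub (hX : HasSymbol a b k X s) (hY : HasSymbol a b k Y s') :
    HasSymbol a b k (X - Y) (s - s') := by
  simpa only [sub_eq_add_neg] using hX.add hY.neg

theorem HasSymbol.pow (hX : HasSymbol a b k X s) (n : ℕ) :
    HasSymbol a b (n * k) (X ^ n) (s ^ n) := by
  induction n with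
  | zero => simpa using hasSymbol_one
  | succ n ih => simpa only [pow_succ, add_mul, one_mul] using ih.mul hX

theorem hasSymbol_zero : HasSymbol a b k (0 : Operator U) 0 :=
  ⟨0, by simp, fun f p _ => by simp, fun t => by simp [conj]⟩

theorem HasSymbol.sum {ι : Type*} (I : Finset ι) {X : ι → Operator U} {s : ι → ℝ × ℝ → ℂ}
    (h : ∀ i ∈ I, HasSymbol a b k (X i) (s i)) :
    HasSymbol a b k (∑ i ∈ I, X i) (∑ i ∈ I, s i) := by
  classical
  induction I using Finset.induction_on with
  | empty => simpa using hasSymbol_zero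
  | insert i I hi ih =>
    rw [Finset.sum_insert hi, Finset.sum_insert hi]
    exact (h i (by simp)).add (ih fun j hj => h j (by simp [hj]))

theorem hasSymbol_dirDeriv (v : ℝ × ℝ) :
    HasSymbol a b 1 (dirDeriv U v) fun _ => a * v.1 + b * v.2 := by
  refine ⟨Polynomial.C (dirDeriv U v) + Polynomial.C ((a * v.1 + b * v.2) • 1) * Polynomial.X, ?_,
    fun f p _ => ?_, fun t => ?_⟩
  · compute_degree
  · simp
  · rw [conj_dirDeriv]
    simp [smul_smul]

theorem hasSymbol_dr : HasSymbol a b 1 (dr U) fun _ => a :=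
  (hasSymbol_dirDeriv (1, 0)).congr fun p _ => by simp

theorem hasSymbol_dθ : HasSymbol a b 1 (dθ U) fun _ => b :=
  (hasSymbol_dirDeriv (0, 1)).congr fun p _ => by simp

/-- The operator polynomial vanishes for every t. Applied to the constant function 1 and evaluated
at `p`, it becomes a scalar polynomial that is identically zero, so its coefficient of degree `k`,
namely s(p), is zero. -/
theorem HasSymbol.eq_zero (h : HasSymbol a b k (0 : Operator U) s) {p : ℝ × ℝ} (hp : p ∈ U) :
    s p = 0 := by
  obtain ⟨Q, h1, h2, h3⟩ := h
  let e : Smooth U := ofFun (fun _ => 1) contDiffOn_const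
  let q : Polynomial ℂ := ∑ i ∈ Finset.range (k + 1),
    Polynomial.monomial i ((Q.coeff i e : ℝ × ℝ → ℂ) p)
  have hq : q = 0 := by
    refine Polynomial.funext fun t => ?_
    have h4 := h3 t
    rw [Polynomial.eval_eq_sum_range' (Nat.lt_succ_of_le h1)] at h4
    have h5 := congrArg (fun X : Operator U => (X e : ℝ × ℝ → ℂ) p) h4
    simp only [conj, mul_zero, zero_mul, LinearMap.zero_apply, LinearMap.sum_apply,
      Submodule.coe_sum, Finset.sum_apply, smul_pow, one_pow, mul_smul_comm, mul_one,
      LinearMap.smul_apply, Submodule.coe_smul, Pi.smul_apply, smul_eq_mul,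
      Submodule.coe_zero, Pi.zero_apply] at h5
    simp only [q, Polynomial.eval_finsetSum, Polynomial.eval_monomial, Polynomial.eval_zero]
    rw [h5]
    exact Finset.sum_congr rfl fun i _ => mul_comm _ _
  have hc : q.coeff k = (Q.coeff k e : ℝ × ℝ → ℂ) p := by
    simp only [q, Polynomial.finsetSum_coeff, Polynomial.coeff_monomial]
    rw [Finset.sum_ite_eq' (Finset.range (k + 1)) k, if_pos (by simp)]
  rw [hq, h2 e p hp, ofFun_apply _ hp] at hc
  simpa using hc.symm

theorem HasSymbol.unique (h : HasSymbol a b k X s) (h' : HasSymbol a b k X s') {p : ℝ × ℝ}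
    (hp : p ∈ U) : s p = s' p := by
  have := h.sub h'
  rw [sub_self] at this
  exact sub_eq_zero.1 (this.eq_zero hp)

/-- An operator of order at most `k + 1` with vanishing symbol of degree `k + 1` has order at
most `k`. -/
theorem mem_diffOps_of_hasSymbol_zero (hX : X ∈ diffOps U (k + 1))
    (h : ∀ a b : ℂ, HasSymbol a b (k + 1) X 0) : X ∈ diffOps U k := by
  obtain ⟨c, rfl⟩ := exists_eq_sum_of_mem_diffOps hX
  -- The symbol is homogeneous in (a, b), so b = 1 loses nothing and leaves a polynomial in the
  -- single variable a whose coefficients are the top-order ones.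
  have hsym : ∀ a : ℂ, HasSymbol a 1 (k + 1) (∑ i ∈ Finset.range (k + 1 + 1),
      ∑ j ∈ Finset.range (k + 1 + 1 - i), mulC (c i j) * (dr U ^ i * dθ U ^ j))
      (∑ i ∈ Finset.range (k + 1 + 1), fun p => (c i (k + 1 - i) : ℝ × ℝ → ℂ) p * a ^ i) := by
    intro a
    refine HasSymbol.sum _ fun i hi => ?_
    rw [Finset.mem_range] at hi
    have hterm : ∀ j, HasSymbol a 1 (i + j) (mulC (c i j) * (dr U ^ i * dθ U ^ j))
        fun p => (c i j : ℝ × ℝ → ℂ) p * a ^ i := by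
      intro j
      have := (hasSymbol_mulC (U := U) (a := a) (b := 1) (c i j)).mul
        ((hasSymbol_dr.pow i).mul (hasSymbol_dθ.pow j))
      rw [mul_one, mul_one, zero_add] at this
      exact this.congr fun p _ => by simp
    have hi' : k + 1 + 1 - i = (k + 1 - i) + 1 := by omega
    rw [hi', Finset.sum_range_succ]
    have h0 : HasSymbol a 1 (k + 1) (∑ j ∈ Finset.range (k + 1 - i),
        mulC (c i j) * (dr U ^ i * dθ U ^ j)) (∑ j ∈ Finset.range (k + 1 - i), 0) :=
      HasSymbol.sum _ fun j hj => (hterm j).of_lt (by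
        rw [Finset.mem_range] at hj
        omega)
    have h1 := hterm (k + 1 - i)
    rw [show i + (k + 1 - i) = k + 1 by omega] at h1
    simpa using h0.add h1
  have hc : ∀ i ∈ Finset.range (k + 1 + 1), c i (k + 1 - i) = 0 := by
    intro i hi
    refine Smooth.ext_on fun p hp => ?_
    let q : Polynomial ℂ := ∑ i ∈ Finset.range (k + 1 + 1),
      Polynomial.monomial i ((c i (k + 1 - i) : ℝ × ℝ → ℂ) p)
    have hq : q = 0 := by
      refine Polynomial.funext fun t => ?_
      have h4 := (hsym t).unique (h t 1) hp
      simp only [Finset.sum_apply, Pi.zero_apply] at h4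
      simp only [q, Polynomial.eval_finsetSum, Polynomial.eval_monomial, Polynomial.eval_zero]
      exact h4
    have hcoeff : q.coeff i = (c i (k + 1 - i) : ℝ × ℝ → ℂ) p := by
      simp only [q, Polynomial.finsetSum_coeff, Polynomial.coeff_monomial]
      rw [Finset.sum_ite_eq' (Finset.range (k + 1 + 1)) i, if_pos hi]
    rw [← hcoeff, hq]
    rfl
  refine Submodule.sum_mem _ fun i hi => Submodule.sum_mem _ fun j hj => ?_
  rw [Finset.mem_range] at hi hj
  rcases Nat.lt_or_ge (i + j) (k + 1) with hlt | hge
  · exact monomial_mem_diffOps _ (by omega)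
  · rw [show j = k + 1 - i by omega, hc i (Finset.mem_range.2 hi)]
    simp

/-! ### Algebraic independence from symbols -/

variable {n : ℕ}

theorem HasSymbol.list_prod {S : Fin n → Operator U} {wt : Fin n → ℕ} {σ : Fin n → ℝ × ℝ → ℂ}
    (h : ∀ i, HasSymbol a b (wt i) (S i) (σ i)) (w : List (Fin n)) :
    HasSymbol a b (w.map wt).sum (w.map S).prod (w.map σ).prod := by
  induction w with
  | nil => exact hasSymbol_one
  | cons i w ih =>
    simp only [List.map_cons, List.prod_cons, List.sum_cons]
    exact (h i).mul ih

theorem HasSymbol.list_sum {l : List (Operator U)} (h : ∀ X ∈ l, HasSymbol a b k X s) :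
    HasSymbol a b k l.sum ((l.length : ℂ) • s) := by
  induction l with
  | nil => simpa using hasSymbol_zero
  | cons X l ih =>
    rw [List.sum_cons, List.length_cons, Nat.cast_add, Nat.cast_one, add_comm, add_smul, one_smul,
      add_comm]
    exact (h X (by simp)).add (ih fun Y hY => h Y (by simp [hY])) |>.congr fun p _ => by
      simp [add_comm]

/-- Symbols are commuting functions, so every ordering of the factors has the same symbol and the
average over orderings keeps it. -/
theorem HasSymbol.symMonomial {S : Fin n → Operator U} {wt : Fin n → ℕ}
    {σ : Fin n → ℝ × ℝ → ℂ} (h : ∀ i, HasSymbol a b (wt i) (S i) (σ i)) (d : Fin n →₀ ℕ) :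
    HasSymbol a b (Finsupp.weight wt d) (symMonomial S d) (∏ i, σ i ^ d i) := by
  set l : List (Fin n) := (Finsupp.toMultiset d).sort (· ≤ ·) with hl
  have hcoe : (l : Multiset (Fin n)) = Finsupp.toMultiset d := Multiset.sort_eq _ _
  have hwt : (l.map wt).sum = Finsupp.weight wt d := by
    rw [← Multiset.sum_coe, ← Multiset.map_coe, hcoe]
    clear hcoe hl l
    induction d using Finsupp.induction_linear with
    | zero => simp
    | add d e hd he => rw [map_add, map_add, Multiset.map_add, Multiset.sum_add, hd, he]
    | single i k => simp [Finsupp.weight_single, Multiset.map_nsmul, Multiset.sum_nsmul]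
  have hσ : (l.map σ).prod = ∏ i, σ i ^ d i := by
    rw [← Multiset.prod_coe, ← Multiset.map_coe, hcoe, Finsupp.toMultiset_map,
      Finsupp.prod_toMultiset, Finsupp.prod_mapDomain_index (by simp) (by simp [pow_add]),
      Finsupp.prod_fintype _ _ (by simp)]
  have hw : ∀ X ∈ l.permutations.map fun w => (w.map S).prod,
      HasSymbol a b (Finsupp.weight wt d) X (∏ i, σ i ^ d i) := by
    intro X hX
    obtain ⟨w, hw, rfl⟩ := List.mem_map.1 hX
    have hperm := List.mem_permutations.1 hw
    rw [← hwt, ← hσ, ← (hperm.map wt).sum_eq, ← (hperm.map σ).prod_eq]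
    exact HasSymbol.list_prod h w
  have := (HasSymbol.list_sum hw).smul ((l.length.factorial : ℂ)⁻¹)
  rw [List.length_map, List.length_permutations, smul_smul,
    inv_mul_cancel₀ (by exact_mod_cast l.length.factorial_ne_zero), one_smul] at this
  exact this

/-- If a nonzero `P` vanished on `S`, take a monomial of largest weight in it. The symbol of
`symEval S P` in that degree is the top weighted component of `P` evaluated at the symbols. It
vanishes, so by `hσ` the component is zero, contradicting the choice of monomial. -/
theorem algIndep_of_hasSymbol {S : Fin n → Operator U} (wt : Fin n → ℕ)
    {σ : ℂ → ℂ → Fin n → ℝ × ℝ → ℂ} (h : ∀ a b i, HasSymbol a b (wt i) (S i) (σ a b i))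
    (hσ : ∀ P : MvPolynomial (Fin n) ℂ,
      (∀ a b, ∀ p ∈ U, MvPolynomial.eval (fun i => σ a b i p) P = 0) → P = 0) :
    AlgIndep S := by
  intro P hP
  by_contra hne
  obtain ⟨d, hd, hmax⟩ := Finset.exists_max_image P.support (Finsupp.weight wt)
    (Finset.nonempty_of_ne_empty (by simpa using hne))
  have hz : MvPolynomial.weightedHomogeneousComponent wt (Finsupp.weight wt d) P = 0 := by
    refine hσ _ fun a b p hp => ?_
    have hs : HasSymbol a b (Finsupp.weight wt d) (symEval S P)
        (∑ e ∈ P.support, if Finsupp.weight wt e = Finsupp.weight wt d then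
          P.coeff e • ∏ i, σ a b i ^ e i else 0) := by
      refine HasSymbol.sum _ fun e he => ?_
      have h1 := (HasSymbol.symMonomial (h a b) e).smul (P.coeff e)
      split_ifs with heq
      · rwa [heq] at h1
      · exact h1.of_lt (lt_of_le_of_ne (hmax e he) heq)
    rw [hP] at hs
    have h0 := hs.eq_zero hp
    rw [MvPolynomial.weightedHomogeneousComponent_apply, map_sum, Finset.sum_filter]
    refine Eq.trans ?_ h0
    rw [Finset.sum_apply]
    refine Finset.sum_congr rfl fun e _ => ?_
    split_ifs
    · simp [MvPolynomial.eval_monomial, Finsupp.prod_fintype]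
    · rfl
  have h1 := congrArg (MvPolynomial.coeff d) hz
  rw [MvPolynomial.coeff_weightedHomogeneousComponent, if_pos rfl] at h1
  exact MvPolynomial.mem_support_iff.1 hd h1

end

section


attribute [local instance] operatorRing

variable {m : ℕ} {α β : ℝ}

/-! ### Orders of the integrals -/

theorem add_mem_diffOps {U : TopologicalSpace.Opens (ℝ × ℝ)} {k : ℕ} {X Y : Operator U}
    (hX : X ∈ diffOps U k) (hY : Y ∈ diffOps U k) : X + Y ∈ diffOps U k :=
  Submodule.add_mem _ hX hY

theorem smul_mem_diffOps {U : TopologicalSpace.Opens (ℝ × ℝ)} {k : ℕ} {X : Operator U} (c : ℂ)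
    (hX : X ∈ diffOps U k) : c • X ∈ diffOps U k :=
  Submodule.smul_mem _ c hX

theorem neg_mem_diffOps {U : TopologicalSpace.Opens (ℝ × ℝ)} {k : ℕ} {X : Operator U}
    (hX : X ∈ diffOps U k) : -X ∈ diffOps U k := by
  simpa using smul_mem_diffOps (-1) hX

theorem sub_mem_diffOps {U : TopologicalSpace.Opens (ℝ × ℝ)} {k : ℕ} {X Y : Operator U}
    (hX : X ∈ diffOps U k) (hY : Y ∈ diffOps U k) : X - Y ∈ diffOps U k := by
  rw [sub_eq_add_neg]
  exact add_mem_diffOps hX (neg_mem_diffOps hY)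

theorem mul_mem_diffOps_of_zero {U : TopologicalSpace.Opens (ℝ × ℝ)} {k : ℕ} {X Y : Operator U}
    (hX : X ∈ diffOps U 0) (hY : Y ∈ diffOps U k) : X * Y ∈ diffOps U k := by
  have := mul_mem_diffOps hX hY
  rwa [zero_add] at this

theorem mul_mem_diffOps_of_add_eq {U : TopologicalSpace.Opens (ℝ × ℝ)} {k l n : ℕ}
    {X Y : Operator U} (h : k + l = n) (hX : X ∈ diffOps U k) (hY : Y ∈ diffOps U l) :
    X * Y ∈ diffOps U n :=
  h ▸ mul_mem_diffOps hX hY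

theorem rPow_mem_diffOps (n : ℤ) : rPow m α β n ∈ diffOps (dom m α β) 0 := mulOp_mem_diffOps _

theorem cosθ_mem_diffOps : cosθ m α β ∈ diffOps (dom m α β) 0 := mulOp_mem_diffOps _

theorem sinθ_mem_diffOps : sinθ m α β ∈ diffOps (dom m α β) 0 := mulOp_mem_diffOps _

theorem sin2θ_mem_diffOps : sin2θ m α β ∈ diffOps (dom m α β) 0 := mulOp_mem_diffOps _

theorem opX_mem_diffOps : opX m α β ∈ diffOps (dom m α β) 0 := mulOp_mem_diffOps _

theorem opw_mem_diffOps : opw m α β ∈ diffOps (dom m α β) 0 := mulOp_mem_diffOps _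

theorem A_mem_diffOps : A m α β ∈ diffOps (dom m α β) 1 := by
  rw [A]
  exact sub_mem_diffOps dθ_mem_diffOps (diffOps_mono zero_le_one opw_mem_diffOps)

theorem Adag_mem_diffOps : Adag m α β ∈ diffOps (dom m α β) 1 := by
  rw [Adag]
  exact sub_mem_diffOps (neg_mem_diffOps dθ_mem_diffOps) (diffOps_mono zero_le_one opw_mem_diffOps)

theorem opS_mem_diffOps : opS m α β ∈ diffOps (dom m α β) 1 := by
  rw [opS]
  exact mul_mem_diffOps_of_zero sin2θ_mem_diffOps dθ_mem_diffOps

theorem A_mul_Adag_mem_diffOps : A m α β * Adag m α β ∈ diffOps (dom m α β) 2 :=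
  mul_mem_diffOps_of_add_eq rfl A_mem_diffOps Adag_mem_diffOps

theorem L2_mem_diffOps : L2 m α β ∈ diffOps (dom m α β) 2 := by
  rw [L2]
  exact add_mem_diffOps A_mul_Adag_mem_diffOps
    (smul_mem_diffOps _ (diffOps_mono (Nat.zero_le 2) one_mem_diffOps))

theorem rPow_mul_dr_mem_diffOps (n : ℤ) :
    rPow m α β n * dr (dom m α β) ∈ diffOps (dom m α β) 1 :=
  mul_mem_diffOps_of_zero (rPow_mem_diffOps n) dr_mem_diffOps

theorem rPow_mul_L2_mem_diffOps (n : ℤ) :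
    rPow m α β n * L2 m α β ∈ diffOps (dom m α β) 2 :=
  mul_mem_diffOps_of_zero (rPow_mem_diffOps n) L2_mem_diffOps

theorem H_mem_diffOps (freq : ℝ) : H m α β freq ∈ diffOps (dom m α β) 2 := by
  rw [H, mul_assoc (_ * _)]
  exact add_mem_diffOps (add_mem_diffOps (neg_mem_diffOps (smul_mem_diffOps _
    (mul_mem_diffOps_of_add_eq rfl (rPow_mul_dr_mem_diffOps _) (rPow_mul_dr_mem_diffOps _))))
    (smul_mem_diffOps _ (diffOps_mono (Nat.zero_le 2) (rPow_mem_diffOps 2))))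
    (smul_mem_diffOps _ (rPow_mul_L2_mem_diffOps (-2)))

theorem L4_mem_diffOps (freq : ℝ) : L4 m α β freq ∈ diffOps (dom m α β) 4 := by
  have h3 : A m α β * opS m α β * Adag m α β ∈ diffOps (dom m α β) 3 :=
    mul_mem_diffOps_of_add_eq rfl (mul_mem_diffOps_of_add_eq rfl A_mem_diffOps opS_mem_diffOps)
      Adag_mem_diffOps
  have h2 : A m α β * opX m α β * Adag m α β ∈ diffOps (dom m α β) 2 :=
    mul_mem_diffOps_of_add_eq rfl (mul_mem_diffOps_of_add_eq rfl A_mem_diffOps opX_mem_diffOps)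
      Adag_mem_diffOps
  have g3 : rPow m α β (-2) - rPow m α β (-1) * dr (dom m α β) ∈ diffOps (dom m α β) 1 :=
    sub_mem_diffOps (diffOps_mono zero_le_one (rPow_mem_diffOps _)) (rPow_mul_dr_mem_diffOps _)
  have g2 : rPow m α β (-1) * dr (dom m α β) - rPow m α β (-2) * L2 m α β + H m α β freq ∈
      diffOps (dom m α β) 2 :=
    add_mem_diffOps (sub_mem_diffOps (diffOps_mono one_le_two (rPow_mul_dr_mem_diffOps _))
      (rPow_mul_L2_mem_diffOps _)) (H_mem_diffOps freq)
  have g0 : rPow m α β (-2) * (A m α β * Adag m α β) ∈ diffOps (dom m α β) 4 :=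
    diffOps_mono (by norm_num : 2 ≤ 4)
      (mul_mem_diffOps_of_zero (rPow_mem_diffOps _) A_mul_Adag_mem_diffOps)
  rw [L4]
  exact smul_mem_diffOps _ (sub_mem_diffOps (add_mem_diffOps (mul_mem_diffOps_of_add_eq rfl h3 g3)
    (mul_mem_diffOps_of_add_eq rfl h2 g2)) (smul_mem_diffOps _ g0))

theorem p1_mem_diffOps : p1 m α β ∈ diffOps (dom m α β) 1 := by
  rw [p1]
  exact sub_mem_diffOps (mul_mem_diffOps_of_zero cosθ_mem_diffOps dr_mem_diffOps)
    (mul_mem_diffOps_of_zero (mul_mem_diffOps_of_zero sinθ_mem_diffOps (rPow_mem_diffOps _))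
      dθ_mem_diffOps)

theorem p2_mem_diffOps : p2 m α β ∈ diffOps (dom m α β) 1 := by
  rw [p2]
  exact add_mem_diffOps (mul_mem_diffOps_of_zero sinθ_mem_diffOps dr_mem_diffOps)
    (mul_mem_diffOps_of_zero (mul_mem_diffOps_of_zero cosθ_mem_diffOps (rPow_mem_diffOps _))
      dθ_mem_diffOps)

theorem leading_mem_diffOps :
    (p1 m α β ^ 2 - p2 m α β ^ 2) * dθ (dom m α β) ^ 2 ∈ diffOps (dom m α β) 4 := by
  rw [pow_two, pow_two, pow_two]
  exact mul_mem_diffOps_of_add_eq rfl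
    (sub_mem_diffOps (mul_mem_diffOps_of_add_eq rfl p1_mem_diffOps p1_mem_diffOps)
      (mul_mem_diffOps_of_add_eq rfl p2_mem_diffOps p2_mem_diffOps))
    (mul_mem_diffOps_of_add_eq rfl dθ_mem_diffOps dθ_mem_diffOps)

/-! ### Symbols of the integrals -/

variable {a b : ℂ}

theorem hasSymbol_rPow (n : ℤ) : HasSymbol a b 0 (rPow m α β n) fun p => (p.1 : ℂ) ^ n :=
  (hasSymbol_mulOp _).congr fun p _ => by push_cast; rfl

/-- The superpotential has order zero and drops out; hence no leading term depends on the seed. -/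
theorem hasSymbol_A : HasSymbol a b 1 (A m α β) fun _ => b :=
  (hasSymbol_dθ.sub ((hasSymbol_mulOp _).of_lt zero_lt_one)).congr fun p _ => by simp

theorem hasSymbol_Adag : HasSymbol a b 1 (Adag m α β) fun _ => -b :=
  (hasSymbol_dθ.neg.sub ((hasSymbol_mulOp _).of_lt zero_lt_one)).congr fun p _ => by simp

theorem hasSymbol_L2 : HasSymbol a b 2 (L2 m α β) fun _ => -b ^ 2 :=
  ((hasSymbol_A.mul hasSymbol_Adag).add_of_lt (hasSymbol_smul_one _) two_pos).congr fun p _ => by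
    simp only [Pi.mul_apply]
    ring

theorem hasSymbol_rPow_mul_L2 : HasSymbol a b 2 (rPow m α β (-2) * L2 m α β)
    fun p => -(b / p.1) ^ 2 := by
  have h := (hasSymbol_rPow (a := a) (b := b) (m := m) (α := α) (β := β) (-2)).mul hasSymbol_L2
  rw [zero_add] at h
  refine h.congr fun p hp => ?_
  have := Complex.ofReal_ne_zero.2 hp.1.ne'
  simp only [Pi.mul_apply, zpow_neg, zpow_ofNat]
  field_simp

theorem hasSymbol_H (freq : ℝ) : HasSymbol a b 2 (H m α β freq)
    fun p => -(a ^ 2 + (b / p.1) ^ 2) / 2 := by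
  have h1 := (((hasSymbol_rPow (a := a) (b := b) (m := m) (α := α) (β := β) (-1)).mul
    hasSymbol_dr).mul (hasSymbol_rPow 1)).mul hasSymbol_dr
  have h2 := hasSymbol_rPow (a := a) (b := b) (m := m) (α := α) (β := β) 2
  refine (((h1.smul (1 / 2)).neg.add_of_lt (h2.smul _) (by norm_num)).add
    (hasSymbol_rPow_mul_L2.smul (1 / 2))).congr fun p hp => ?_
  have := Complex.ofReal_ne_zero.2 hp.1.ne'
  simp only [Pi.mul_apply, Pi.add_apply, Pi.neg_apply, Pi.smul_apply, smul_eq_mul, zpow_neg,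
    zpow_one]
  field_simp
  ring

/-- The symbol of `L₄`. -/
def symbolL4 (a b : ℂ) (p : ℝ × ℝ) : ℂ :=
  -(1 / 4) * ((a ^ 2 - (b / p.1) ^ 2) * Real.cos (2 * p.2) -
    2 * a * (b / p.1) * Real.sin (2 * p.2)) * b ^ 2

theorem hasSymbol_L4 (freq : ℝ) : HasSymbol a b 4 (L4 m α β freq) (symbolL4 a b) := by
  have hS : HasSymbol a b 1 (opS m α β) fun p => (Real.sin (2 * p.2) : ℂ) * b :=
    (hasSymbol_mulOp (U := dom m α β) (a := a) (b := b)
      (g := fun p => Real.sin (2 * p.2)) (by fun_prop)).mul hasSymbol_dθ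
  have hX : HasSymbol a b 0 (opX m α β) fun p => (xvar p.2 : ℂ) := hasSymbol_mulOp _
  have hE : HasSymbol a b 1 (rPow m α β (-1) * dr (dom m α β)) fun p => a / p.1 := by
    have h := (hasSymbol_rPow (a := a) (b := b) (m := m) (α := α) (β := β) (-1)).mul hasSymbol_dr
    rw [zero_add] at h
    refine h.congr fun p _ => ?_
    simp only [Pi.mul_apply, zpow_neg, zpow_one]
    ring
  have h3 := ((hasSymbol_A.mul hS).mul hasSymbol_Adag).mul
    (((hasSymbol_rPow (-2)).of_lt zero_lt_one).sub hE)
  have h2 := ((hasSymbol_A.mul hX).mul hasSymbol_Adag).mul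
    (((hE.of_lt one_lt_two).sub hasSymbol_rPow_mul_L2).add (hasSymbol_H freq))
  have h0 := (((hasSymbol_rPow (a := a) (b := b) (m := m) (α := α) (β := β) (-2)).mul
    (hasSymbol_A.mul hasSymbol_Adag)).smul (delta α β : ℂ)).of_lt (l := 4) (by norm_num)
  refine (((h3.add h2).sub h0).smul (1 / 2)).congr fun p _ => ?_
  simp only [Pi.mul_apply, Pi.add_apply, Pi.sub_apply, Pi.zero_apply, Pi.smul_apply, smul_eq_mul,
    symbolL4, xvar]
  push_cast
  ring

/-- The Cartesian momenta have symbols (a, b/r) rotated by θ, so the difference of their squares is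
rotated by 2θ. -/
theorem hasSymbol_leading :
    HasSymbol a b 4 ((p1 m α β ^ 2 - p2 m α β ^ 2) * dθ (dom m α β) ^ 2)
      ((-4 : ℂ) • symbolL4 a b) := by
  have hc : HasSymbol a b 0 (cosθ m α β) fun p => (Real.cos p.2 : ℂ) := hasSymbol_mulOp _
  have hs : HasSymbol a b 0 (sinθ m α β) fun p => (Real.sin p.2 : ℂ) := hasSymbol_mulOp _
  have hr := hasSymbol_rPow (a := a) (b := b) (m := m) (α := α) (β := β) (-1)
  have h1 : HasSymbol a b 1 (p1 m α β) _ :=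
    (hc.mul hasSymbol_dr).sub ((hs.mul hr).mul hasSymbol_dθ)
  have h2 : HasSymbol a b 1 (p2 m α β) _ :=
    (hs.mul hasSymbol_dr).add ((hc.mul hr).mul hasSymbol_dθ)
  refine (((h1.pow 2).sub (h2.pow 2)).mul (hasSymbol_dθ.pow 2)).congr fun p _ => ?_
  simp only [Pi.mul_apply, Pi.add_apply, Pi.sub_apply, Pi.pow_apply, Pi.smul_apply, smul_eq_mul,
    symbolL4, Real.cos_two_mul', Real.sin_two_mul, zpow_neg, zpow_one]
  push_cast
  ring

theorem isDiffOp_L4_sub_leading (freq : ℝ) : IsDiffOp (dom m α β) 3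
    (L4 m α β freq - (-(1 / 4) : ℂ) •
      ((p1 m α β ^ 2 - p2 m α β ^ 2) * dθ (dom m α β) ^ 2)) := by
  refine isDiffOp_of_mem_diffOps (mem_diffOps_of_hasSymbol_zero
    (sub_mem_diffOps (L4_mem_diffOps freq) (smul_mem_diffOps _ leading_mem_diffOps)) fun a b => ?_)
  refine ((hasSymbol_L4 freq).sub (hasSymbol_leading.smul _)).congr fun p _ => ?_
  simp only [Pi.sub_apply, Pi.smul_apply, smul_eq_mul, Pi.zero_apply]
  ring

/-! ### Algebraic independence -/

/-- As θ runs over (0, π/2), x runs over (-1, 1), and a nonzero polynomial cannot vanish on all of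
it. -/
theorem angles_nonempty (hP : seedPoly m α β ≠ 0) : (angles m α β).Nonempty := by
  by_contra hne
  refine hP (Polynomial.eq_zero_of_infinite_isRoot _
    ((Set.Ioo_infinite (show (-1 : ℝ) < 1 by norm_num)).mono fun y hy => ?_))
  have hx : xvar (Real.arccos (-y) / 2) = y := by
    rw [xvar, mul_div_cancel₀ _ two_ne_zero, Real.cos_arccos (by linarith [hy.2])
      (by linarith [hy.1]), neg_neg]
  by_contra hroot
  refine hne ⟨Real.arccos (-y) / 2, ?_, ?_, ?_⟩
  · have := Real.arccos_pos.2 (show -y < 1 by linarith [hy.1])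
    positivity
  · have : Real.arccos (-y) < Real.pi := by
      refine lt_of_le_of_ne (Real.arccos_le_pi _) fun h => ?_
      rw [Real.arccos_eq_pi] at h
      linarith [hy.2]
    linarith
  · rwa [hx]

/-- The values of `u² + v²` and `(u² - v²) cos 2θ - 2 u v sin 2θ` can be prescribed independently
within bounds. -/
theorem exists_covector (θ : ℝ) {s K : ℝ} (hs : 0 < s) (h1 : -s ≤ K)
    (h2 : K < -(|Real.cos (2 * θ)| * s)) :
    ∃ u v : ℝ, 0 < v ∧ u ^ 2 + v ^ 2 = s ∧
      (u ^ 2 - v ^ 2) * Real.cos (2 * θ) - 2 * u * v * Real.sin (2 * θ) = K := by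
  have hK : K ≤ s := by nlinarith [abs_nonneg (Real.cos (2 * θ))]
  -- In polar form (u, v) = √s (cos ψ, sin ψ) the second quantity equals s cos(2θ + 2ψ).
  obtain ⟨ψ, hψ⟩ : ∃ ψ, Real.cos (2 * θ + 2 * ψ) = K / s :=
    ⟨Real.arccos (K / s) / 2 - θ, by
      rw [show 2 * θ + 2 * (Real.arccos (K / s) / 2 - θ) = Real.arccos (K / s) by ring]
      exact Real.cos_arccos (by rw [le_div_iff₀ hs]; linarith) (by rw [div_le_one hs]; exact hK)⟩
  have hq := Real.sq_sqrt hs.le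
  have hsc := Real.sin_sq_add_cos_sq ψ
  have e1 : (√s * Real.cos ψ) ^ 2 + (√s * Real.sin ψ) ^ 2 = s := by
    rw [mul_pow, mul_pow, hq]
    linear_combination s * hsc
  have e2 : ((√s * Real.cos ψ) ^ 2 - (√s * Real.sin ψ) ^ 2) * Real.cos (2 * θ) -
      2 * (√s * Real.cos ψ) * (√s * Real.sin ψ) * Real.sin (2 * θ) = K := by
    rw [Real.cos_add, Real.cos_two_mul' ψ, Real.sin_two_mul ψ, eq_div_iff hs.ne'] at hψ
    linear_combination hψ + (((Real.cos ψ) ^ 2 - (Real.sin ψ) ^ 2) * Real.cos (2 * θ) -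
      2 * Real.cos ψ * Real.sin ψ * Real.sin (2 * θ)) * hq
  generalize √s * Real.cos ψ = u at e1 e2
  generalize √s * Real.sin ψ = v at e1 e2
  -- v = 0 would force K = s cos 2θ, which `h2` excludes. Afterwards v > 0 can be arranged, since
  -- both equations are invariant under (u, v) ↦ (-u, -v).
  have hv : v ≠ 0 := by
    rintro rfl
    have h3 : K = s * Real.cos (2 * θ) := by rw [← e1, ← e2]; ring
    nlinarith [neg_abs_le (Real.cos (2 * θ))]
  rcases hv.lt_or_gt with h | h
  · exact ⟨-u, -v, by linarith, by linear_combination e1, by linear_combination e2⟩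
  · exact ⟨u, v, h, e1, e2⟩

/-- The symbols of `H`, `L₂`, `L₄`. -/
def symbols (a b : ℂ) : Fin 3 → ℝ × ℝ → ℂ :=
  ![fun p => -(a ^ 2 + (b / p.1) ^ 2) / 2, fun _ => -b ^ 2, symbolL4 a b]

/-- At one fixed admissible angle, a, b and r are still free, and the three symbols take every value
in a product of real intervals. A polynomial vanishing on a product of infinite sets is zero. -/
theorem eq_zero_of_eval_symbols (hP : seedPoly m α β ≠ 0) (P : MvPolynomial (Fin 3) ℂ)
    (h : ∀ a b : ℂ, ∀ p ∈ dom m α β, MvPolynomial.eval (fun i => symbols a b i p) P = 0) :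
    P = 0 := by
  obtain ⟨θ, hθ⟩ := angles_nonempty hP
  have hκ : |Real.cos (2 * θ)| < 1 := by
    have hs : 0 < Real.sin (2 * θ) := by
      rw [Real.sin_two_mul]
      have := sin_pos_of_mem hθ
      have := cos_pos_of_mem hθ
      positivity
    rw [← sq_lt_one_iff_abs_lt_one]
    nlinarith [Real.sin_sq_add_cos_sq (2 * θ)]
  set κ := |Real.cos (2 * θ)| with hκdef
  have hκ0 : 0 ≤ κ := abs_nonneg _
  -- With s = -2y₀ in (1, M) and b² = -y₁ in (1, N), the value K = 4y₂/y₁ must satisfy -s ≤ K < -κs.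
  -- The condition NMκ < 1 leaves room for an interval of y₂ that works for all such y₀ and y₁ at
  -- once.
  obtain ⟨M, hM1, hM2⟩ : ∃ M : ℝ, 1 < M ∧ M * κ < 1 :=
    ⟨2 / (1 + κ), by rw [lt_div_iff₀ (by linarith)]; linarith, by
      rw [div_mul_eq_mul_div, div_lt_one (by linarith)]; linarith⟩
  obtain ⟨N, hN1, hN2⟩ : ∃ N : ℝ, 1 < N ∧ N * (M * κ) < 1 := by
    have h0 : 0 ≤ M * κ := by positivity
    exact ⟨2 / (1 + M * κ), by rw [lt_div_iff₀ (by linarith)]; linarith, by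
      rw [div_mul_eq_mul_div, div_lt_one (by linarith)]; linarith⟩
  let I : Fin 3 → Set ℝ := ![Set.Ioo (-M / 2) (-1 / 2), Set.Ioo (-N) (-1),
    Set.Ioo (N * (M * κ) / 4) (1 / 4)]
  have hI : ∀ i, (I i).Infinite := by
    intro i
    fin_cases i
    · exact Set.Ioo_infinite (by linarith)
    · exact Set.Ioo_infinite (by linarith)
    · exact Set.Ioo_infinite (by linarith)
  refine MvPolynomial.funext_set (fun i => Complex.ofReal '' I i)
    (fun i => (hI i).image Complex.ofReal_injective.injOn) fun x hx => ?_
  rw [map_zero]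
  choose y hy hyx using fun i => hx i (Set.mem_univ i)
  obtain ⟨hh1, hh2⟩ : -M / 2 < y 0 ∧ y 0 < -1 / 2 := hy 0
  obtain ⟨hl1, hl2⟩ : -N < y 1 ∧ y 1 < -1 := hy 1
  obtain ⟨hk1, hk2⟩ : N * (M * κ) / 4 < y 2 ∧ y 2 < 1 / 4 := hy 2
  have hk0 : 0 < y 2 := lt_of_le_of_lt (by positivity) hk1
  obtain ⟨u, v, hv, e1, e2⟩ := exists_covector θ (s := -2 * y 0) (K := 4 * y 2 / y 1)
    (by linarith) (by rw [le_div_iff_of_neg (by linarith)]; nlinarith)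
    (by
      rw [div_lt_iff_of_neg (by linarith)]
      have h1 : κ * (-2 * y 0) ≤ M * κ := by nlinarith
      have h2 : -(κ * (-2 * y 0)) * y 1 ≤ M * κ * N := by
        have : 0 ≤ κ * (-2 * y 0) := mul_nonneg hκ0 (by linarith)
        nlinarith
      linarith)
  have hb := Real.sq_sqrt (show 0 ≤ -y 1 by linarith)
  have hbC : ((√(-y 1) : ℝ) : ℂ) ^ 2 = -(y 1 : ℂ) := by exact_mod_cast hb
  have hb0 : 0 < √(-y 1) := Real.sqrt_pos.2 (by linarith)
  -- The radius is chosen as b/v, so that b/r = v; this is why v had to be positive.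
  have hmem : (√(-y 1) / v, θ) ∈ dom m α β := ⟨by positivity, hθ⟩
  rw [← h u (√(-y 1)) _ hmem]
  congr 2
  have hdiv : ((√(-y 1) : ℝ) : ℂ) / ((√(-y 1) / v : ℝ) : ℂ) = (v : ℂ) := by
    rw [← Complex.ofReal_div]
    congr 1
    field_simp
  rw [eq_div_iff (by linarith)] at e2
  funext i
  rw [← hyx i]
  fin_cases i
  · simp only [symbols, Fin.zero_eta, Matrix.cons_val_zero, hdiv]
    have : y 0 = -(u ^ 2 + v ^ 2) / 2 := by linarith
    rw [this]
    push_cast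
    ring
  · simp only [symbols, Fin.mk_one, Matrix.cons_val_one, Matrix.cons_val_zero]
    rw [hbC, neg_neg]
  · simp only [symbols, Fin.reduceFinMk, Matrix.cons_val, symbolL4, hdiv]
    rw [hbC]
    have e3 := congrArg (fun t : ℝ => (t : ℂ)) e2
    push_cast at e3 ⊢
    linear_combination -e3 / 4

theorem algIndep_integrals (hP : seedPoly m α β ≠ 0) (freq : ℝ) :
    AlgIndep ![H m α β freq, L2 m α β, L4 m α β freq] := by
  refine algIndep_of_hasSymbol (σ := symbols) ![2, 2, 4] (fun a b i => ?_)
    (eq_zero_of_eval_symbols hP)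
  fin_cases i
  · exact hasSymbol_H freq
  · exact hasSymbol_L2
  · exact hasSymbol_L4 freq

theorem superintegrable_H (hP : seedPoly m α β ≠ 0) (freq : ℝ) :
    Superintegrable (dom m α β) (H m α β freq) :=
  ⟨L2 m α β, L4 m α β freq, ⟨⟨2, isDiffOp_of_mem_diffOps (H_mem_diffOps freq)⟩, rfl⟩,
    ⟨⟨2, isDiffOp_of_mem_diffOps L2_mem_diffOps⟩, (H_commute_L2 freq).eq⟩,
    ⟨⟨4, isDiffOp_of_mem_diffOps (L4_mem_diffOps freq)⟩, (H_commute_L4 freq).eq⟩,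
    algIndep_integrals hP freq⟩

/-! ### Separation of variables -/

theorem dr_apply_eq_deriv {U : TopologicalSpace.Opens (ℝ × ℝ)} (f : Smooth U) {p : ℝ × ℝ}
    (hp : p ∈ U) :
    (dr U f : ℝ × ℝ → ℂ) p = deriv (fun t => (f : ℝ × ℝ → ℂ) (t, p.2)) p.1 := by
  have h := ((Smooth.differentiableAt f hp).hasFDerivAt).comp_hasDerivAt p.1
    (f := fun t : ℝ => (t, p.2)) ((hasDerivAt_id p.1).prodMk (hasDerivAt_const p.1 p.2))
  rw [dr, dirDeriv_apply _ _ hp]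
  exact h.deriv.symm

theorem dθ_apply_eq_deriv {U : TopologicalSpace.Opens (ℝ × ℝ)} (f : Smooth U) {p : ℝ × ℝ}
    (hp : p ∈ U) :
    (dθ U f : ℝ × ℝ → ℂ) p = deriv (fun t => (f : ℝ × ℝ → ℂ) (p.1, t)) p.2 := by
  have h := ((Smooth.differentiableAt f hp).hasFDerivAt).comp_hasDerivAt p.2
    (f := fun t : ℝ => (p.1, t)) ((hasDerivAt_const p.2 p.1).prodMk (hasDerivAt_id p.2))
  rw [dθ, dirDeriv_apply _ _ hp]
  exact h.deriv.symm

variable {f : Smooth (dom m α β)} {R Ψ : ℝ → ℂ}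

theorem dr_apply_of_product (hf : ∀ p ∈ dom m α β, (f : ℝ × ℝ → ℂ) p = R p.1 * Ψ p.2)
    {p : ℝ × ℝ} (hp : p ∈ dom m α β) :
    (dr (dom m α β) f : ℝ × ℝ → ℂ) p = deriv R p.1 * Ψ p.2 := by
  rw [dr_apply_eq_deriv f hp]
  have he : (fun t => (f : ℝ × ℝ → ℂ) (t, p.2)) =ᶠ[nhds p.1] fun t => R t * Ψ p.2 := by
    filter_upwards [lt_mem_nhds hp.1] with t ht using hf (t, p.2) ⟨ht, hp.2⟩
  rw [he.deriv_eq, deriv_mul_const_field]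

theorem dθ_apply_of_product (hf : ∀ p ∈ dom m α β, (f : ℝ × ℝ → ℂ) p = R p.1 * Ψ p.2)
    {p : ℝ × ℝ} (hp : p ∈ dom m α β) :
    (dθ (dom m α β) f : ℝ × ℝ → ℂ) p = R p.1 * deriv Ψ p.2 := by
  rw [dθ_apply_eq_deriv f hp]
  have he : (fun t => (f : ℝ × ℝ → ℂ) (p.1, t)) =ᶠ[nhds p.2] fun t => R p.1 * Ψ t := by
    filter_upwards [(isOpen_angles m α β).mem_nhds hp.2] with t ht using hf (p.1, t) ⟨hp.1, ht⟩
  rw [he.deriv_eq, deriv_const_mul_field]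

theorem L2_of_product {lam : ℂ} (hf : ∀ p ∈ dom m α β, (f : ℝ × ℝ → ℂ) p = R p.1 * Ψ p.2)
    (hΨ : ∀ θ ∈ angles m α β,
      -deriv (deriv Ψ) θ + (extPotential m α β θ : ℂ) * Ψ θ = lam * Ψ θ) :
    L2 m α β f = lam • f :=
  Smooth.ext_on fun p hp => by
    -- The θ-derivative of a product RΨ is again a product, RΨ', so the first-derivative formula is
    -- used twice.
    rw [L2_apply f hp, pow_two, Module.End.mul_apply,
      dθ_apply_of_product (fun q hq => dθ_apply_of_product hf hq) hp, hf p hp, Submodule.coe_smul,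
      Pi.smul_apply, hf p hp, smul_eq_mul]
    linear_combination R p.1 * hΨ p.2 hp.2

theorem H_apply_of_product (freq : ℝ) {lam : ℂ}
    (hf : ∀ p ∈ dom m α β, (f : ℝ × ℝ → ℂ) p = R p.1 * Ψ p.2)
    (hL : L2 m α β f = lam • f) {p : ℝ × ℝ} (hp : p ∈ dom m α β) :
    (H m α β freq f : ℝ × ℝ → ℂ) p = radial freq lam R p.1 * Ψ p.2 := by
  have h1 : ∀ q ∈ dom m α β, (rPow m α β 1 (dr (dom m α β) f) : ℝ × ℝ → ℂ) q =
      ((q.1 : ℂ) * deriv R q.1) * Ψ q.2 := by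
    intro q hq
    rw [rPow, mulOp_apply, dr_apply_of_product hf hq, zpow_one, mul_assoc]
  -- r∂_r applied to the product is again a product, with radial factor rR', so the outer ∂_r is
  -- covered by the same lemma.
  have h2 := dr_apply_of_product (R := fun s : ℝ => (s : ℂ) * deriv R s) h1 hp
  have hr : ∀ (n : ℤ) (g : Smooth (dom m α β)), (rPow m α β n g : ℝ × ℝ → ℂ) p =
      (p.1 : ℂ) ^ n * (g : ℝ × ℝ → ℂ) p := by
    intro n g
    rw [rPow, mulOp_apply]
    push_cast
    rfl
  have hp0 := Complex.ofReal_ne_zero.2 hp.1.ne'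
  simp only [H, Module.End.mul_apply, LinearMap.add_apply, LinearMap.neg_apply,
    LinearMap.smul_apply, Submodule.coe_add, Submodule.coe_neg, Submodule.coe_smul, Pi.add_apply,
    Pi.neg_apply, Pi.smul_apply, smul_eq_mul, hL, map_smul, radial]
  rw [hr (-1), h2, hr 2, hr (-2), hf p hp, zpow_neg, zpow_neg, zpow_one, zpow_ofNat]
  field_simp

end

end

end RosenMorse

theorem proposition2 (m : ℕ) (α β freq : ℝ) (hP : RosenMorse.seedPoly m α β ≠ 0) :
    -- the factorization: the partner operator `A† A + const` is the trigonometric operator with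
    -- shifted parameters, and `L₂ = A A† + const` is its rational extension
    (∀ f : RosenMorse.Smooth (RosenMorse.dom m α β), ∀ p ∈ RosenMorse.dom m α β,
      ((RosenMorse.Adag m α β * RosenMorse.A m α β +
          (RosenMorse.shift m α β : ℂ) • 1) f : ℝ × ℝ → ℂ) p =
        -((RosenMorse.dθ (RosenMorse.dom m α β) ^ 2) f : ℝ × ℝ → ℂ) p +
          (RosenMorse.trigPotential (α + 1) (β - 1) p.2 : ℂ) * (f : ℝ × ℝ → ℂ) p) ∧
    (∀ f : RosenMorse.Smooth (RosenMorse.dom m α β), ∀ p ∈ RosenMorse.dom m α β,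
      (RosenMorse.L2 m α β f : ℝ × ℝ → ℂ) p =
        -((RosenMorse.dθ (RosenMorse.dom m α β) ^ 2) f : ℝ × ℝ → ℂ) p +
          (RosenMorse.extPotential m α β p.2 : ℂ) * (f : ℝ × ℝ → ℂ) p) ∧
    -- superintegrability
    RosenMorse.Superintegrable (RosenMorse.dom m α β) (RosenMorse.H m α β freq) ∧
    RosenMorse.AlgIndep
      ![RosenMorse.H m α β freq, RosenMorse.L2 m α β, RosenMorse.L4 m α β freq] ∧
    -- `L₂` is a second-order integral
    RosenMorse.H m α β freq * RosenMorse.L2 m α β = RosenMorse.L2 m α β * RosenMorse.H m α β freq ∧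
    RosenMorse.IsDiffOp (RosenMorse.dom m α β) 2 (RosenMorse.L2 m α β) ∧
    -- separation of variables in polar coordinates, with separation constant the value of `L₂`
    (∀ (Φ : RosenMorse.Smooth (RosenMorse.dom m α β)) (R Ψ : ℝ → ℂ) (lam : ℂ),
      ContDiffOn ℝ ∞ R (Set.Ioi 0) →
      ContDiffOn ℝ ∞ Ψ (RosenMorse.angles m α β) →
      (∀ p ∈ RosenMorse.dom m α β, (Φ : ℝ × ℝ → ℂ) p = R p.1 * Ψ p.2) →
      (∀ θ ∈ RosenMorse.angles m α β,
        -deriv (deriv Ψ) θ + (RosenMorse.extPotential m α β θ : ℂ) * Ψ θ = lam * Ψ θ) →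
      RosenMorse.L2 m α β Φ = lam • Φ ∧
      ∀ p ∈ RosenMorse.dom m α β,
        (RosenMorse.H m α β freq Φ : ℝ × ℝ → ℂ) p = RosenMorse.radial freq lam R p.1 * Ψ p.2) ∧
    -- `L₄` is a fourth-order integral
    RosenMorse.H m α β freq * RosenMorse.L4 m α β freq =
      RosenMorse.L4 m α β freq * RosenMorse.H m α β freq ∧
    RosenMorse.IsDiffOp (RosenMorse.dom m α β) 4 (RosenMorse.L4 m α β freq) ∧
    -- `L₄` in terms of the ladder operators, on joint eigenfunctions of `L₂` and `H`
    (∀ (Φ : RosenMorse.Smooth (RosenMorse.dom m α β)) (Λ E : ℂ),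
      Λ ≠ 0 → Λ ≠ 1 → Λ ≠ -1 →
      RosenMorse.L2 m α β Φ = Λ ^ 2 • Φ → RosenMorse.H m α β freq Φ = E • Φ →
      RosenMorse.L4 m α β freq Φ =
        (1 / (4 * Λ * (1 - Λ))) •
            (RosenMorse.BLadder m α β Λ * RosenMorse.CLadder m α β (-Λ) E) Φ
          - (1 / (4 * Λ * (1 + Λ))) •
            (RosenMorse.BLadder m α β (-Λ) * RosenMorse.CLadder m α β Λ E) Φ
          + ((RosenMorse.delta α β : ℂ) * E / (2 * (1 - Λ ^ 2))) •
            (RosenMorse.A m α β * RosenMorse.Adag m α β) Φ) ∧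
    -- the leading term of `L₄`, the same for every seed: `-(1/4) (p₁² - p₂²) M²`
    RosenMorse.IsDiffOp (RosenMorse.dom m α β) 3
      (RosenMorse.L4 m α β freq -
        (-(1 / 4) : ℂ) • ((RosenMorse.p1 m α β ^ 2 - RosenMorse.p2 m α β ^ 2) *
          RosenMorse.dθ (RosenMorse.dom m α β) ^ 2)) := by
  exact ⟨fun f _ hp => RosenMorse.Adag_mul_A_apply f hp, fun f _ hp => RosenMorse.L2_apply f hp,
    RosenMorse.superintegrable_H hP freq, RosenMorse.algIndep_integrals hP freq,
    (RosenMorse.H_commute_L2 freq).eq,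
    RosenMorse.isDiffOp_of_mem_diffOps RosenMorse.L2_mem_diffOps,
    fun _ _ _ _ _ _ hΦ hΨ => ⟨RosenMorse.L2_of_product hΦ hΨ, fun _ hp =>
      RosenMorse.H_apply_of_product freq hΦ (RosenMorse.L2_of_product hΦ hΨ) hp⟩,
    (RosenMorse.H_commute_L4 freq).eq,
    RosenMorse.isDiffOp_of_mem_diffOps (RosenMorse.L4_mem_diffOps freq),
    fun _ _ _ h0 h1 h1' hL hH => RosenMorse.L4_apply_of_eigen h0 h1 h1' hL hH,
    RosenMorse.isDiffOp_L4_sub_leading freq⟩
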